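/- For a C*-algebra $A$: $A$ is *scattered* if every nonzero quotient of $A$ contains a nonzero minimal projection, i.e. a projection $p\neq 0$ with $pBp=\mathbb{C}p$ in the quotient $B$; $A$ is *AF* if it has a directed family of finite-dimensional C*-subalgebras with dense union; the *density* of $A$ is the least cardinality of a norm-dense subset. C*-subalgebras need not contain the unit of the ambient algebra. A *Canadian tree* is a partially ordered set in which the strict predecessors of every element are well-ordered, which has height $\omega_1$, all of whose levels have cardinality at most $\omega_1$, and which has more than $\omega_1$ branches (maximal linearly ordered subsets) of height $\omega_1$. A *Boolean embedding* is an injective homomorphism of Boolean algebras, and $\wp(\mathbb{N})/\mathrm{Fin}$ is the Boolean algebra of subsets of $\mathbb{N}$ modulo finite sets. The following hold in ZFC. 1. There is a scattered C*-subalgebra of $\mathcal{B}(\ell_2(\omega_2))$ of density $\omega_2$ which is not AF. 2. There is a scattered C*-subalgebra of $\mathcal{B}(\ell_2(2^\omega))$ of density bigger than $2^\omega$ which is not AF. 3. If there exists a Canadian tree, then there is a scattered C*-subalgebra of $\mathcal{B}(\ell_2(\omega_1))$ of density bigger than $\omega_1$ which is not AF. 4. If there exist a Canadian tree and a Boolean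 embedding $E:\wp(\omega_1)\rightarrow\wp(\mathbb{N})/\mathrm{Fin}$, then there is a scattered C*-subalgebra of $\mathcal{B}(\ell_2)$ of density bigger than $\omega_1$ which is not AF. -/

import Mathlib

open scoped Cardinal Ordinal

universe u

/-! ### C*-algebras -/

/-- The density of a topological space: the least cardinality of a dense subset. -/
noncomputable def density (X : Type*) [TopologicalSpace X] : Cardinal :=
  sInf {c : Cardinal | ∃ s : Set X, Dense s ∧ #s = c}

/-- A nonzero minimal projection of a C*-algebra: a projection `p ≠ 0` with `pAp = ℂp`
(the inclusion `ℂp ⊆ pAp` is automatic). -/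
structure IsMinimalProjection {A : Type*} [NonUnitalCStarAlgebra A] (p : A) : Prop where
  isStarProjection : IsStarProjection p
  ne_zero : p ≠ 0
  corner : ∀ a : A, ∃ c : ℂ, p * a * p = c • p

/-- A C*-algebra is scattered if each of its nonzero quotients contains a nonzero minimal
projection. The quotients of `A` by closed two-sided ideals are, up to isomorphism, the
C*-algebras `B` onto which `A` maps by a `*`-homomorphism. -/
def IsScatteredCStar (A : Type u) [NonUnitalCStarAlgebra A] : Prop :=
  ∀ (B : Type u) [NonUnitalCStarAlgebra B] (f : A →⋆ₙₐ[ℂ] B),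
    Function.Surjective f → Nontrivial B → ∃ p : B, IsMinimalProjection p

/-- A C*-algebra is approximately finite-dimensional (AF) if it has a directed family of
finite-dimensional C*-subalgebras with dense union. -/
def IsAF (A : Type*) [NonUnitalCStarAlgebra A] : Prop :=
  ∃ S : Set (NonUnitalStarSubalgebra ℂ A), S.Nonempty ∧ DirectedOn (· ≤ ·) S ∧
    (∀ B ∈ S, FiniteDimensional ℂ B) ∧ Dense (⋃ B ∈ S, (B : Set A))

/-- The C*-algebra `B(ℓ₂(ι))` of bounded operators on the Hilbert space of square summable
complex functions on `ι`. -/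
abbrev BoundedOperatorsL2 (ι : Type*) : Type _ :=
  lp (fun _ : ι => ℂ) 2 →L[ℂ] lp (fun _ : ι => ℂ) 2

/-! ### Trees -/

/-- A tree: a partial order in which the set of strict predecessors of each element is
well-ordered. -/
class IsSetTree (T : Type*) [PartialOrder T] : Prop where
  wellOrder_Iio : ∀ t : T, IsWellOrder (Set.Iio t) (· < ·)

/-- The height of an element of a tree: the order type of its set of strict predecessors. -/
noncomputable def nodeHeight {T : Type*} [PartialOrder T] [IsSetTree T] (t : T) : Ordinal :=
  haveI := IsSetTree.wellOrder_Iio t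
  Ordinal.type (fun x y : Set.Iio t => x < y)

/-- The height of a subset `S` of a tree: the supremum of `ht(s) + 1` over `s ∈ S`. -/
noncomputable def subsetHeight {T : Type*} [PartialOrder T] [IsSetTree T] (S : Set T) : Ordinal :=
  ⨆ s : S, (nodeHeight (s : T) + 1)

/-- The `α`-th level of a tree. -/
def treeLevel (T : Type u) [PartialOrder T] [IsSetTree T] (α : Ordinal.{u}) : Set T :=
  {t | nodeHeight t = α}

/-- The set of `α`-branches of a tree: its maximal linearly ordered subsets of height `α`. -/
def treeBranches (T : Type u) [PartialOrder T] [IsSetTree T] (α : Ordinal.{u}) : Set (Set T) :=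
  {b | IsMaxChain (· ≤ ·) b ∧ subsetHeight b = α}

/-- A Canadian tree (weak Kurepa tree): a tree of height `ω₁` whose levels have cardinality at
most `ℵ₁` and which has more than `ℵ₁` many `ω₁`-branches. -/
structure IsCanadianTree (T : Type u) [PartialOrder T] : Prop extends IsSetTree T where
  height_eq : subsetHeight (Set.univ : Set T) = ω₁
  level_le : ∀ α : Ordinal.{u}, #(treeLevel T α) ≤ ℵ₁
  lt_branches : ℵ₁ < #(treeBranches T ω₁)

/-! ### Subsets of the natural numbers modulo finite sets -/

/-- The Boolean algebra `℘(ℕ)/Fin`: subsets of `ℕ`, viewed as predicates, where two of them are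
identified if they agree at all but finitely many points. -/
abbrev PowersetModFin : Type := Filter.Germ (Filter.cofinite : Filter ℕ) Prop

/-- The class of a set of natural numbers in `℘(ℕ)/Fin`. -/
def PowersetModFin.mk (A : Set ℕ) : PowersetModFin := ((fun n => n ∈ A : ℕ → Prop) :)

theorem PowersetModFin.mk_eq_mk_iff (A B : Set ℕ) :
    PowersetModFin.mk A = PowersetModFin.mk B ↔ (symmDiff A B).Finite := by
  unfold PowersetModFin.mk
  rw [Filter.Germ.coe_eq, Filter.EventuallyEq, Filter.eventually_cofinite]
  have h : {n | ¬ ((n ∈ A) = (n ∈ B))} = symmDiff A B := by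
    ext n
    simp only [Set.mem_ofPred_eq, eq_iff_iff, Set.mem_symmDiff]
    tauto
  rw [h]

theorem PowersetModFin.mk_le_mk_iff (A B : Set ℕ) :
    PowersetModFin.mk A ≤ PowersetModFin.mk B ↔ (A \ B).Finite := by
  unfold PowersetModFin.mk
  rw [Filter.Germ.coe_le, Filter.EventuallyLE, Filter.eventually_cofinite]
  have h : {n | ¬ ((n ∈ A) ≤ (n ∈ B))} = A \ B := by
    ext n
    simp
  rw [h]

/-- A Boolean embedding of `℘(X)` into `℘(ℕ)/Fin`: an injective map preserving finite joins and
meets, `0` and `1` (and hence complements). -/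
def HasBooleanEmbedding (X : Type*) : Prop :=
  ∃ E : BoundedLatticeHom (Set X) PowersetModFin, Function.Injective E

open Filter Topology InnerProductSpace
open scoped ENNReal

/-! ### Transport of C*-algebraic properties along homomorphisms -/

/-! All the algebras consist of bounded fields of 2×2 matrices over `P × ℕ`, generated by the fields
supported at single points (these span a dense part of the ideal of fields vanishing at infinity)
and by rank-one projection fields `p_a`. Over its support, `p_a` is at `(t, n)` the projection onto
the line of angle `slope a t / (n + 1)`. Along each fibre `{t} × ℕ` all these lines converge to one
line, so modulo fields vanishing at infinity only the supports matter, apart from finitely many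
points `t` where slopes disagree.

Scattered: a quotient either sees some point, where a rank-one matrix gives a minimal projection, or
kills everything vanishing at infinity. In the latter case `p_a p_b` becomes `0` or some `p_c` with
`c = a` or `c` below `a` in a well-founded relation, so a minimal surviving `p_a` is a minimal
projection (`ProjectionSystem.isScattered`).

Not AF: for each `ξ` in a large index set, every element of the algebra is eventually a scalar
multiple of `p_ξ` along a countably complete filter. Hence the unit of a finite-dimensional
subalgebra close to `p_ξ` eventually equals `p_ξ`. If two such subalgebras lie in a common one, its
unit fixes two distinct lines at every point of some fibre, hence is the identity there; but all
elements of the algebra tend to `0` on the second basis vector along that fibre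
(`ProjectionSystem.IsTwisted.not_isAF`).

It remains to find combinatorial data in which two `p_ξ` always clash. On pairs from a set of size
above `ℵ₁`, a free-set argument does it; the slope records which element of the pair is larger. For
more branches than nodes, pigeonhole gives two branches sharing a node beyond both thresholds, and
the clash occurs where they split. Branches come from binary sequences of the least length `κ` with
`2 ^ κ > 𝔠`, or from a Canadian tree. Block-diagonal operators represent the fields on `ℓ₂`.

For `B(ℓ₂)`, a Boolean embedding pulls free ultrafilters on `ℕ` back to `X`. Pairs of fields on `ℕ`
and `X` with matching limits form an extension of the given algebra by the fields on `ℕ` vanishing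
at infinity, and injectivity of the embedding makes this extension act faithfully on `ℕ` alone. -/

theorem IsScatteredCStar.of_surjective {A B : Type u} [NonUnitalCStarAlgebra A]
    [NonUnitalCStarAlgebra B] (h : IsScatteredCStar A) (φ : A →⋆ₙₐ[ℂ] B)
    (hφ : Function.Surjective φ) : IsScatteredCStar B := fun C _ f hf hC =>
  h C (f.comp φ) (by simpa using hf.comp hφ) hC

theorem NonUnitalStarAlgHom.continuous_of_cstar {A B : Type*} [NonUnitalCStarAlgebra A]
    [NonUnitalCStarAlgebra B] (φ : A →⋆ₙₐ[ℂ] B) : Continuous φ :=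
  AddMonoidHomClass.continuous_of_bound φ 1 fun a => by
    simpa using NonUnitalStarAlgHom.norm_apply_le φ a

theorem IsAF.of_surjective {A B : Type*} [NonUnitalCStarAlgebra A] [NonUnitalCStarAlgebra B]
    (h : IsAF A) (φ : A →⋆ₙₐ[ℂ] B) (hφ : Function.Surjective φ) : IsAF B := by
  obtain ⟨S, hne, hdir, hfin, hdense⟩ := h
  refine ⟨(fun C => C.map φ) '' S, hne.image _, ?_, ?_, ?_⟩
  · rintro _ ⟨C, hC, rfl⟩ _ ⟨D, hD, rfl⟩
    obtain ⟨E, hE, h1, h2⟩ := hdir C hC D hD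
    exact ⟨_, ⟨E, hE, rfl⟩, NonUnitalStarSubalgebra.map_mono h1,
      NonUnitalStarSubalgebra.map_mono h2⟩
  · rintro _ ⟨C, hC, rfl⟩
    have := hfin C hC
    let g : C →ₗ[ℂ] (C.map φ) :=
      { toFun := fun c => ⟨φ c, c, c.2, rfl⟩
        map_add' := fun a b => Subtype.ext (map_add φ _ _)
        map_smul' := fun a b => Subtype.ext (map_smul φ _ _) }
    refine Module.Finite.of_surjective g ?_
    rintro ⟨_, c, hc, rfl⟩
    exact ⟨⟨c, hc⟩, rfl⟩
  · have := hφ.denseRange.dense_image φ.continuous_of_cstar hdense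
    refine this.mono ?_
    rintro _ ⟨a, ha, rfl⟩
    simp only [Set.mem_iUnion, exists_prop] at ha ⊢
    obtain ⟨C, hC, haC⟩ := ha
    exact ⟨_, ⟨C, hC, rfl⟩, a, haC, rfl⟩

/-! ### Density, and images of injective homomorphisms -/

theorem density_le_of_dense {X : Type*} [TopologicalSpace X] {s : Set X} (hs : Dense s) :
    density X ≤ #s :=
  csInf_le' ⟨s, hs, rfl⟩

theorem exists_dense_card_eq_density (X : Type*) [TopologicalSpace X] :
    ∃ s : Set X, Dense s ∧ #s = density X :=
  csInf_mem (s := {c : Cardinal | ∃ s : Set X, Dense s ∧ #s = c}) ⟨_, _, dense_univ, rfl⟩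

theorem density_le_of_surjective {X Y : Type u} [TopologicalSpace X] [TopologicalSpace Y]
    {f : X → Y} (hf : Function.Surjective f) (hc : Continuous f) : density Y ≤ density X := by
  obtain ⟨s, hs, hcard⟩ := exists_dense_card_eq_density X
  rw [← hcard]
  exact (density_le_of_dense (hf.denseRange.dense_image hc hs)).trans Cardinal.mk_image_le

/-- A space with a family of points any two of which are at distance at least `1` has density at
least the size of the family. -/
theorem card_le_density {X Λ : Type u} [PseudoMetricSpace X] (p : Λ → X)
    (hp : ∀ ξ η, ξ ≠ η → 1 ≤ dist (p ξ) (p η)) : #Λ ≤ density X := by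
  obtain ⟨s, hs, hcard⟩ := exists_dense_card_eq_density X
  have h : ∀ ξ, ∃ y ∈ s, dist (p ξ) y < 1 / 2 := fun ξ => hs.exists_dist_lt _ (by norm_num)
  choose q hqs hq using h
  rw [← hcard]
  refine Cardinal.mk_le_of_injective (f := fun ξ => (⟨q ξ, hqs ξ⟩ : s)) fun ξ η h => ?_
  by_contra hne
  have h' : q ξ = q η := congrArg Subtype.val h
  have h1 := hp ξ η hne
  have h2 := dist_triangle_right (p ξ) (p η) (q ξ)
  have h3 := hq ξ
  have h4 := hq η
  rw [← h'] at h4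
  linarith

/-- An injective `*`-homomorphism of C*-algebras is isometric, so its range is closed and isomorphic
to the source. -/
theorem exists_closed_subalgebra_of_injective {G H : Type u} [NonUnitalCStarAlgebra G]
    [NonUnitalCStarAlgebra H] (φ : G →⋆ₙₐ[ℂ] H) (hφ : Function.Injective φ)
    (hG : IsScatteredCStar G) (hAF : ¬ IsAF G) :
    ∃ (A : NonUnitalStarSubalgebra ℂ H) (_ : IsClosed (A : Set H)),
      IsScatteredCStar A ∧ density A = density G ∧ ¬ IsAF A := by
  have hcl : IsClosed ((NonUnitalStarAlgHom.range φ : NonUnitalStarSubalgebra ℂ H) : Set H) := by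
    rw [NonUnitalStarAlgHom.coe_range]
    exact (NonUnitalStarAlgHom.isometry φ hφ).isClosedEmbedding.isClosed_range
  let e := StarAlgEquiv.ofInjective' φ hφ
  let e1 : G →⋆ₙₐ[ℂ] NonUnitalStarAlgHom.range φ := (e : G →⋆ₙₐ[ℂ] NonUnitalStarAlgHom.range φ)
  let e2 : NonUnitalStarAlgHom.range φ →⋆ₙₐ[ℂ] G :=
    (e.symm : NonUnitalStarAlgHom.range φ →⋆ₙₐ[ℂ] G)
  have h1 : Function.Surjective e1 := e.surjective
  have h2 : Function.Surjective e2 := e.symm.surjective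
  refine ⟨NonUnitalStarAlgHom.range φ, hcl, hG.of_surjective e1 h1, le_antisymm ?_ ?_, ?_⟩
  · exact density_le_of_surjective h1 e1.continuous_of_cstar
  · exact density_le_of_surjective h2 e2.continuous_of_cstar
  · exact fun h => hAF (h.of_surjective e2 h2)

/-- A finite-dimensional subalgebra of a C*-algebra has a left unit. -/
theorem exists_left_unit_of_finiteDimensional {A : Type*} [NonUnitalCStarAlgebra A]
    (B : NonUnitalStarSubalgebra ℂ A) [FiniteDimensional ℂ B] :
    ∃ u ∈ B, ∀ b ∈ B, u * b = b := by
  have : IsClosed (B : Set A) :=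
    Submodule.closed_of_finiteDimensional (B.toNonUnitalSubalgebra.toSubmodule)
  let : PartialOrder B := CStarAlgebra.spectralOrder B
  have : StarOrderedRing B := CStarAlgebra.spectralOrderedRing B
  have : ProperSpace B := FiniteDimensional.proper ℂ B
  have hl := CStarAlgebra.increasingApproximateUnit B
  -- The unit ball is compact, so an approximate unit converges along an ultrafilter; the limit is a
  -- unit.
  let F : Ultrafilter B := Ultrafilter.of (CStarAlgebra.approximateUnit B)
  have hF : (F : Filter B) ≤ CStarAlgebra.approximateUnit B := Ultrafilter.of_le _
  obtain ⟨u, -, hu⟩ := (isCompact_closedBall (0 : B) 1).ultrafilter_le_nhds F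
    (le_principal_iff.2 (hF hl.closedBall_mem))
  refine ⟨u, u.2, fun b hb => ?_⟩
  have h1 : Tendsto (fun x : B => x * ⟨b, hb⟩) F (𝓝 ⟨b, hb⟩) :=
    (hl.tendsto_mul_right ⟨b, hb⟩).mono_left hF
  have h2 : Tendsto (fun x : B => x * ⟨b, hb⟩) F (𝓝 (u * ⟨b, hb⟩)) :=
    ((continuous_id.mul continuous_const).tendsto u).mono_left hu
  exact congrArg Subtype.val (tendsto_nhds_unique h2 h1)

/-! ### Bounded fields of operators on the plane -/

/-- The Hilbert space `ℂ²`. -/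
def Plane : Type := EuclideanSpace ℂ (Fin 2)

namespace Plane

noncomputable instance : NormedAddCommGroup Plane :=
  inferInstanceAs (NormedAddCommGroup (EuclideanSpace ℂ (Fin 2)))

noncomputable instance : InnerProductSpace ℂ Plane :=
  inferInstanceAs (InnerProductSpace ℂ (EuclideanSpace ℂ (Fin 2)))

instance : FiniteDimensional ℂ Plane :=
  inferInstanceAs (FiniteDimensional ℂ (EuclideanSpace ℂ (Fin 2)))

instance : CompleteSpace Plane := FiniteDimensional.complete ℂ Plane

/-- The standard orthonormal basis of `ℂ²`. -/
noncomputable def basis : OrthonormalBasis (Fin 2) ℂ Plane :=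
  EuclideanSpace.basisFun (Fin 2) ℂ

end Plane

/-- The C*-algebra of operators on `ℂ²`. -/
abbrev PlaneOp : Type := Plane →L[ℂ] Plane

/-- The C*-algebra of bounded functions from `X` to the operators on `ℂ²`. -/
def BoundedField (X : Type*) : Type _ := lp (fun _ : X => PlaneOp) ∞

namespace BoundedField

variable {X : Type*}

noncomputable instance : NonUnitalCStarAlgebra (BoundedField X) :=
  inferInstanceAs (NonUnitalCStarAlgebra (lp (fun _ : X => PlaneOp) ∞))

instance : FunLike (BoundedField X) X PlaneOp where
  coe f := f.1
  coe_injective _ _ h := Subtype.ext h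

/-- The bounded field given by a function with an explicit bound. -/
def ofBound (f : X → PlaneOp) (C : ℝ) (h : ∀ x, ‖f x‖ ≤ C) : BoundedField X :=
  ⟨f, memℓp_infty ⟨C, by rintro _ ⟨x, rfl⟩; exact h x⟩⟩

@[simp] theorem ofBound_apply (f : X → PlaneOp) (C : ℝ) (h : ∀ x, ‖f x‖ ≤ C) (x : X) :
    ofBound f C h x = f x := rfl

theorem norm_apply_le (f : BoundedField X) (x : X) : ‖f x‖ ≤ ‖f‖ :=
  lp.norm_apply_le_norm ENNReal.top_ne_zero f x

theorem norm_le {f : BoundedField X} {C : ℝ} (hC : 0 ≤ C) (h : ∀ x, ‖f x‖ ≤ C) : ‖f‖ ≤ C :=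
  lp.norm_le_of_forall_le hC h

@[ext] theorem ext {f g : BoundedField X} (h : ∀ x, f x = g x) : f = g := DFunLike.ext _ _ h

@[simp] theorem zero_apply (x : X) : (0 : BoundedField X) x = 0 := rfl
@[simp] theorem add_apply (f g : BoundedField X) (x : X) : (f + g) x = f x + g x := rfl
@[simp] theorem sub_apply (f g : BoundedField X) (x : X) : (f - g) x = f x - g x := rfl
@[simp] theorem mul_apply (f g : BoundedField X) (x : X) : (f * g) x = f x * g x := rfl
@[simp] theorem smul_apply (c : ℂ) (f : BoundedField X) (x : X) : (c • f) x = c • f x := rfl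
@[simp] theorem star_apply (f : BoundedField X) (x : X) : (star f) x = star (f x) := rfl

@[simp] theorem sum_apply {κ : Type*} (s : Finset κ) (f : κ → BoundedField X) (x : X) :
    (∑ i ∈ s, f i) x = ∑ i ∈ s, f i x := by
  classical
  induction s using Finset.induction_on with
  | empty => simp
  | insert i s hi ih => rw [Finset.sum_insert hi, Finset.sum_insert hi, add_apply, ih]

theorem continuous_apply (x : X) : Continuous fun f : BoundedField X => f x :=
  (lp.lipschitzWith_one_eval (E := fun _ : X => PlaneOp) ∞ x).continuous

open Classical in
/-- The field supported at one point. -/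
noncomputable def single (x : X) (m : PlaneOp) : BoundedField X := lp.single ∞ x m

@[simp] theorem single_self (x : X) (m : PlaneOp) : single x m x = m := by
  classical
  exact lp.single_apply_self _ _ _

theorem single_of_ne {x y : X} (h : y ≠ x) (m : PlaneOp) : single x m y = 0 := by
  classical
  exact lp.single_apply_ne _ _ _ h

theorem ext_single {x : X} {f g : BoundedField X} (h : f x = g x)
    (h' : ∀ y, y ≠ x → f y = g y) : f = g := by
  ext1 y
  by_cases hy : y = x
  · rw [hy, h]
  · exact h' y hy

theorem single_mul_single (x : X) (m m' : PlaneOp) :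
    single x m * single x m' = single x (m * m') :=
  ext_single (x := x) (by simp) fun y hy => by simp [single_of_ne hy]

theorem single_sum {κ : Type*} (x : X) (s : Finset κ) (m : κ → PlaneOp) :
    single x (∑ i ∈ s, m i) = ∑ i ∈ s, single x (m i) :=
  ext_single (x := x) (by simp) fun y hy => by simp [single_of_ne hy]

theorem single_smul (x : X) (c : ℂ) (m : PlaneOp) : c • single x m = single x (c • m) :=
  ext_single (x := x) (by simp) fun y hy => by
    rw [smul_apply, single_of_ne hy, single_of_ne hy, smul_zero]

theorem star_single (x : X) (m : PlaneOp) : star (single x m) = single x (star m) :=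
  ext_single (x := x) (by simp) fun y hy => by simp [single_of_ne hy]

theorem single_mul_mul_single (x : X) (m m' : PlaneOp) (f : BoundedField X) :
    single x m * f * single x m' = single x (m * f x * m') :=
  ext_single (x := x) (by simp) fun y hy => by simp [single_of_ne hy]

/-- A field vanishes at infinity if it is small off a finite set. -/
def VanishesAtInfinity (f : BoundedField X) : Prop := ∀ ε > 0, {x | ε ≤ ‖f x‖}.Finite

end BoundedField

theorem rankOne_mul_mul_rankOne (v : Plane) (m : PlaneOp) :
    rankOne ℂ v v * m * rankOne ℂ v v = (inner ℂ v (m v) : ℂ) • rankOne ℂ v v := by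
  ext1 w
  simp [smul_smul, mul_comm]

theorem isStarProjection_rankOne {v : Plane} (hv : ‖v‖ = 1) :
    IsStarProjection (rankOne ℂ v v : PlaneOp) where
  isIdempotentElem := isIdempotentElem_rankOne_self hv
  isSelfAdjoint := by
    rw [ContinuousLinearMap.isSelfAdjoint_iff_isSymmetric]
    intro x y
    simp [inner_smul_left, inner_smul_right, mul_comm]

theorem planeOp_eq_sum (m : PlaneOp) :
    m = ∑ i, m * rankOne ℂ (Plane.basis i) (Plane.basis i) := by
  rw [← Finset.mul_sum, Plane.basis.sum_rankOne_eq_id]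
  rfl

theorem NonUnitalStarAlgHom.norm_map_le {A B : Type*} [NonUnitalCStarAlgebra A]
    [NonUnitalCStarAlgebra B] (φ : A →⋆ₙₐ[ℂ] B) (a : A) : ‖φ a‖ ≤ ‖a‖ :=
  NonUnitalStarAlgHom.norm_apply_le φ a

/-- Let `G` be a C*-algebra of bounded fields which contains all fields supported at single points.
A quotient of `G` either contains a minimal projection or kills all fields of `G` which vanish at
infinity. -/
theorem exists_isMinimalProjection_or_eq_zero {X : Type*} {G B : Type*} [NonUnitalCStarAlgebra G]
    [NonUnitalCStarAlgebra B] (φ : G →⋆ₙₐ[ℂ] BoundedField X) (hφ : Function.Injective φ)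
    (hs : ∀ x m, ∃ g, φ g = BoundedField.single x m) (f : G →⋆ₙₐ[ℂ] B)
    (hf : Function.Surjective f) :
    (∃ p : B, IsMinimalProjection p) ∨ ∀ g, (φ g).VanishesAtInfinity → f g = 0 := by
  choose s hs using hs
  by_cases h : ∀ x m, f (s x m) = 0
  · right
    intro g hg
    refine norm_le_zero_iff.1 (le_of_forall_pos_le_add fun ε hε => ?_)
    rw [zero_add]
    -- Subtracting the finitely many large values does not change the image under `f` and leaves a
    -- field of norm at most `ε`.
    have hfin := hg ε hε
    have hsum : f (∑ x ∈ hfin.toFinset, s x (φ g x)) = 0 := by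
      rw [map_sum]
      exact Finset.sum_eq_zero fun x _ => h _ _
    calc ‖f g‖ = ‖f (g - ∑ x ∈ hfin.toFinset, s x (φ g x))‖ := by rw [map_sub, hsum, sub_zero]
      _ ≤ ‖g - ∑ x ∈ hfin.toFinset, s x (φ g x)‖ := f.norm_map_le _
      _ = ‖φ (g - ∑ x ∈ hfin.toFinset, s x (φ g x))‖ := (NonUnitalStarAlgHom.norm_map φ hφ _).symm
      _ ≤ ε := by
        refine BoundedField.norm_le hε.le fun y => ?_
        rw [map_sub, map_sum, BoundedField.sub_apply, BoundedField.sum_apply]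
        simp only [hs]
        by_cases hy : y ∈ hfin.toFinset
        · rw [Finset.sum_eq_single_of_mem y hy
            fun x _ hx => BoundedField.single_of_ne hx.symm _]
          simpa using hε.le
        · rw [Finset.sum_eq_zero fun x hx => BoundedField.single_of_ne
            (fun h => hy (by rwa [h])) _, sub_zero]
          simp only [Set.Finite.mem_toFinset, Set.mem_ofPred_eq, not_le] at hy
          exact hy.le
  · left
    push Not at h
    obtain ⟨x, m, hm⟩ := h
    -- Any matrix is a sum of its products with rank-one basis projections, so some rank-one
    -- projection at `x` survives.
    obtain ⟨v, hv, hne⟩ : ∃ v : Plane, ‖v‖ = 1 ∧ f (s x (rankOne ℂ v v)) ≠ 0 := by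
      by_contra! hcon
      apply hm
      have : s x m = ∑ i, s x m * s x (rankOne ℂ (Plane.basis i) (Plane.basis i)) := by
        apply hφ
        simp only [map_sum, map_mul, hs, BoundedField.single_mul_single, ← BoundedField.single_sum]
        rw [← planeOp_eq_sum]
      rw [this, map_sum]
      refine Finset.sum_eq_zero fun i _ => ?_
      rw [map_mul, hcon _ (Plane.basis.norm_eq_one i), mul_zero]
    have hp := isStarProjection_rankOne hv
    refine ⟨_, ⟨⟨?_, ?_⟩, hne, ?_⟩⟩
    · change f _ * f _ = f _
      rw [← map_mul]
      congr 1
      apply hφ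
      rw [map_mul, hs, BoundedField.single_mul_single, hp.isIdempotentElem.eq]
    · change star (f _) = f _
      rw [← map_star]
      congr 1
      apply hφ
      rw [map_star, hs, BoundedField.star_single, hp.isSelfAdjoint.star_eq]
    · intro b
      obtain ⟨a, rfl⟩ := hf b
      refine ⟨inner ℂ v (φ a x v), ?_⟩
      rw [← map_mul, ← map_mul, ← map_smul]
      congr 1
      apply hφ
      rw [map_mul, map_mul, map_smul, hs, BoundedField.single_mul_mul_single,
        rankOne_mul_mul_rankOne, BoundedField.single_smul]

/-! ### Lines in the plane -/

/-- The unit vector of angle `θ`. -/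
noncomputable def unitVec (θ : ℝ) : Plane :=
  (Real.cos θ : ℂ) • Plane.basis 0 + (Real.sin θ : ℂ) • Plane.basis 1

theorem Plane.inner_basis (i j : Fin 2) :
    (inner ℂ (Plane.basis i) (Plane.basis j) : ℂ) = if i = j then 1 else 0 :=
  orthonormal_iff_ite.1 Plane.basis.orthonormal i j

theorem inner_unitVec_self (θ : ℝ) : (inner ℂ (unitVec θ) (unitVec θ) : ℂ) = 1 := by
  simp only [unitVec, inner_add_left, inner_add_right, inner_smul_left, inner_smul_right,
    Plane.inner_basis, Complex.conj_ofReal]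
  norm_num
  norm_cast
  nlinarith [Real.sin_sq_add_cos_sq θ]

theorem norm_unitVec (θ : ℝ) : ‖unitVec θ‖ = 1 := by
  have h2 : ‖unitVec θ‖ ^ 2 = 1 := by
    rw [← inner_self_eq_norm_sq (𝕜 := ℂ), inner_unitVec_self]
    simp
  nlinarith [norm_nonneg (unitVec θ)]

theorem inner_unitVec_basis_one (θ : ℝ) :
    (inner ℂ (unitVec θ) (Plane.basis 1) : ℂ) = Real.sin θ := by
  simp only [unitVec, inner_add_left, inner_smul_left, Plane.inner_basis, Complex.conj_ofReal]
  norm_num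

/-- The projection onto the line of angle `θ`. -/
noncomputable def lineProj (θ : ℝ) : PlaneOp := rankOne ℂ (unitVec θ) (unitVec θ)

theorem isStarProjection_lineProj (θ : ℝ) : IsStarProjection (lineProj θ) :=
  isStarProjection_rankOne (norm_unitVec θ)

theorem norm_lineProj (θ : ℝ) : ‖lineProj θ‖ = 1 := by
  simp [lineProj, norm_unitVec]

theorem lineProj_unitVec (θ : ℝ) : lineProj θ (unitVec θ) = unitVec θ := by
  simp [lineProj, norm_unitVec]

theorem lineProj_basis_one (θ : ℝ) :
    lineProj θ (Plane.basis 1) = (Real.sin θ : ℂ) • unitVec θ := by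
  rw [lineProj, rankOne_apply, inner_unitVec_basis_one]

theorem continuous_lineProj : Continuous lineProj := by
  have h : lineProj = fun θ : ℝ =>
      ((Real.cos θ : ℂ) * Real.cos θ) • (rankOne ℂ (Plane.basis 0) (Plane.basis 0) : PlaneOp) +
      ((Real.cos θ : ℂ) * Real.sin θ) • (rankOne ℂ (Plane.basis 0) (Plane.basis 1) : PlaneOp) +
      ((Real.cos θ : ℂ) * Real.sin θ) • (rankOne ℂ (Plane.basis 1) (Plane.basis 0) : PlaneOp) +
      ((Real.sin θ : ℂ) * Real.sin θ) • (rankOne ℂ (Plane.basis 1) (Plane.basis 1) : PlaneOp) := by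
    funext θ
    ext1 v
    simp only [lineProj, unitVec, rankOne_apply, inner_add_left, inner_smul_left,
      Complex.conj_ofReal, add_apply, smul_apply]
    module
  rw [h]
  fun_prop

/-- An operator fixing two different lines fixes the second basis vector. -/
theorem apply_basis_one_of_fixed {q : PlaneOp} {θ θ' : ℝ} (h : q (unitVec θ) = unitVec θ)
    (h' : q (unitVec θ') = unitVec θ') (hθ : θ ∈ Set.Icc (0 : ℝ) 1) (hθ' : θ' ∈ Set.Icc (0 : ℝ) 1)
    (hne : θ ≠ θ') : q (Plane.basis 1) = Plane.basis 1 := by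
  have key : (Real.sin (θ' - θ) : ℂ) • Plane.basis 1 =
      (Real.cos θ : ℂ) • unitVec θ' - (Real.cos θ' : ℂ) • unitVec θ := by
    rw [Real.sin_sub, unitVec, unitVec]
    push_cast
    module
  have hs : Real.sin (θ' - θ) ≠ 0 := by
    intro h0
    apply hne
    have hpi := Real.pi_gt_three
    -- Angles in `[0, 1]` differ by less than `π`, so distinct angles give distinct lines.
    have := (Real.sin_eq_zero_iff_of_lt_of_lt (by linarith [hθ.1, hθ.2, hθ'.1, hθ'.2])
      (by linarith [hθ.1, hθ.2, hθ'.1, hθ'.2])).1 h0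
    linarith
  have hq : (Real.sin (θ' - θ) : ℂ) • q (Plane.basis 1) =
      (Real.sin (θ' - θ) : ℂ) • Plane.basis 1 := by
    rw [← map_smul, key, map_sub, map_smul, map_smul, h, h']
  exact smul_right_injective _ (by exact_mod_cast hs) hq

/-! ### Systems of projections -/

/-- Combinatorial data for a family of rank-one projection fields `p_a` over `P × ℕ`: the field
`p_a` lives on `supp a × ℕ`, where its value at `(t, n)` is the projection onto the line of angle
`slope a t / (n + 1)`. The products `p_a p_b` are described by a well-founded relation. -/
structure ProjectionSystem (P N : Type*) where
  /-- The support of a field. -/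
  supp : N → Set P
  /-- The slopes of a field. -/
  slope : N → P → ℝ
  slope_mem : ∀ a t, slope a t ∈ Set.Icc (0 : ℝ) 1
  /-- The relation along which minimal fields are found. -/
  rel : N → N → Prop
  wellFounded : WellFounded rel
  meet : ∀ a b, Disjoint (supp a) (supp b) ∨ ∃ c, (c = a ∨ rel c a) ∧ supp a ∩ supp b = supp c ∧
    {t ∈ supp c | ¬ (slope a t = slope c t ∧ slope b t = slope c t)}.Finite

namespace ProjectionSystem

variable {P N : Type*} (S : ProjectionSystem P N)

/-- The angle of a projection field at a point. -/
noncomputable def angle (a : N) (x : P × ℕ) : ℝ := S.slope a x.1 / (x.2 + 1)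

theorem angle_mem (a : N) (x : P × ℕ) : S.angle a x ∈ Set.Icc (0 : ℝ) 1 := by
  have h := S.slope_mem a x.1
  have h0 : (0 : ℝ) < x.2 + 1 := by positivity
  refine ⟨div_nonneg h.1 h0.le, (div_le_one h0).2 (h.2.trans ?_)⟩
  simp

theorem tendsto_angle (a : N) (t : P) :
    Tendsto (fun n : ℕ => S.angle a (t, n)) atTop (𝓝 0) :=
  (tendsto_const_nhds (x := S.slope a t)).div_atTop
    (tendsto_atTop_add_const_right _ (1 : ℝ) tendsto_natCast_atTop_atTop)

open Classical in
/-- The projection field with a given index. -/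
noncomputable def gen (a : N) : BoundedField (P × ℕ) :=
  BoundedField.ofBound (fun x => if x.1 ∈ S.supp a then lineProj (S.angle a x) else 0) 1
    fun x => by split_ifs <;> simp [norm_lineProj]

theorem gen_of_mem {a : N} {x : P × ℕ} (h : x.1 ∈ S.supp a) :
    S.gen a x = lineProj (S.angle a x) := if_pos h

theorem gen_of_notMem {a : N} {x : P × ℕ} (h : x.1 ∉ S.supp a) : S.gen a x = 0 := if_neg h

theorem isStarProjection_gen (a : N) : IsStarProjection (S.gen a) where
  isIdempotentElem := by
    change S.gen a * S.gen a = S.gen a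
    ext1 x
    by_cases h : x.1 ∈ S.supp a
    · rw [BoundedField.mul_apply, S.gen_of_mem h, (isStarProjection_lineProj _).isIdempotentElem.eq]
    · rw [BoundedField.mul_apply, S.gen_of_notMem h, mul_zero]
  isSelfAdjoint := by
    change star (S.gen a) = S.gen a
    ext1 x
    by_cases h : x.1 ∈ S.supp a
    · rw [BoundedField.star_apply, S.gen_of_mem h, (isStarProjection_lineProj _).isSelfAdjoint.star_eq]
    · rw [BoundedField.star_apply, S.gen_of_notMem h, star_zero]

theorem gen_mul_gen_of_disjoint {a b : N} (h : Disjoint (S.supp a) (S.supp b)) :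
    S.gen a * S.gen b = 0 := by
  ext1 x
  by_cases hx : x.1 ∈ S.supp a
  · rw [BoundedField.mul_apply, S.gen_of_notMem (Set.disjoint_left.1 h hx), mul_zero,
      BoundedField.zero_apply]
  · rw [BoundedField.mul_apply, S.gen_of_notMem hx, zero_mul, BoundedField.zero_apply]

theorem tendsto_gen (a : N) {t : P} (ht : t ∈ S.supp a) :
    Tendsto (fun n : ℕ => S.gen a (t, n)) atTop (𝓝 (lineProj 0)) := by
  have : (fun n : ℕ => S.gen a (t, n)) = fun n => lineProj (S.angle a (t, n)) :=
    funext fun n => S.gen_of_mem ht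
  rw [this]
  exact (continuous_lineProj.tendsto 0).comp (S.tendsto_angle a t)

/-- Where the slopes agree the difference is exactly `0`. Over each of the finitely many other `t`,
all three projections converge to `lineProj 0`, so only finitely many `n` give a large value. -/
theorem vanishesAtInfinity_gen_mul_gen {a b c : N} (hsupp : S.supp a ∩ S.supp b = S.supp c)
    (hfin : {t ∈ S.supp c |
      ¬ (S.slope a t = S.slope c t ∧ S.slope b t = S.slope c t)}.Finite) :
    (S.gen a * S.gen b - S.gen c).VanishesAtInfinity := by
  intro ε hε
  have hev : ∀ t ∈ S.supp c, ∃ n₀ : ℕ, ∀ n ≥ n₀,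
      ‖(S.gen a * S.gen b - S.gen c) (t, n)‖ < ε := by
    intro t ht
    have hab : t ∈ S.supp a ∩ S.supp b := hsupp ▸ ht
    have h := ((S.tendsto_gen a hab.1).mul (S.tendsto_gen b hab.2)).sub (S.tendsto_gen c ht)
    rw [(isStarProjection_lineProj _).isIdempotentElem.eq, sub_self] at h
    have h' := (tendsto_zero_iff_norm_tendsto_zero.1 h).eventually (gt_mem_nhds hε)
    exact eventually_atTop.1 h'
  choose! n₀ hn₀ using hev
  refine (hfin.biUnion fun t _ => (Set.finite_lt_nat (n₀ t)).image fun n => (t, n)).subset ?_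
  rintro ⟨t, n⟩ hx
  simp only [Set.mem_ofPred_eq, BoundedField.sub_apply, BoundedField.mul_apply] at hx
  have hzero : ¬ (S.gen a (t, n) * S.gen b (t, n) - S.gen c (t, n) = 0) := fun h => by
    rw [h, norm_zero] at hx
    linarith
  have hc : t ∈ S.supp c := by
    by_contra hc
    apply hzero
    have h' : ¬ (t ∈ S.supp a ∧ t ∈ S.supp b) := fun h => hc (hsupp ▸ h)
    rw [S.gen_of_notMem (x := (t, n)) hc, sub_zero]
    by_cases ha : t ∈ S.supp a
    · rw [S.gen_of_notMem (x := (t, n)) (fun hb => h' ⟨ha, hb⟩), mul_zero]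
    · rw [S.gen_of_notMem (x := (t, n)) ha, zero_mul]
  have hab : t ∈ S.supp a ∩ S.supp b := hsupp ▸ hc
  have hbad : t ∈ {t ∈ S.supp c | ¬ (S.slope a t = S.slope c t ∧ S.slope b t = S.slope c t)} := by
    refine ⟨hc, fun ⟨h1, h2⟩ => hzero ?_⟩
    rw [S.gen_of_mem (x := (t, n)) hc, S.gen_of_mem (x := (t, n)) hab.1,
      S.gen_of_mem (x := (t, n)) hab.2]
    simp only [angle, h1, h2]
    rw [(isStarProjection_lineProj _).isIdempotentElem.eq, sub_self]
  simp only [Set.mem_iUnion, exists_prop]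
  refine ⟨t, hbad, n, ?_, rfl⟩
  by_contra hn
  exact (hn₀ t hc n (not_lt.1 hn)).not_ge hx

/-- The set of generators of the C*-algebra of a system of projections: the matrix units at
single points and the projection fields. -/
def generators : Set (BoundedField (P × ℕ)) :=
  Set.range (fun y : (P × ℕ) × Fin 2 × Fin 2 =>
    BoundedField.single y.1 (rankOne ℂ (Plane.basis y.2.1) (Plane.basis y.2.2))) ∪ Set.range S.gen

/-- The C*-algebra of a system of projections. -/
noncomputable def algebra : NonUnitalStarSubalgebra ℂ (BoundedField (P × ℕ)) :=
  (NonUnitalStarAlgebra.adjoin ℂ S.generators).topologicalClosure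

instance isClosed_algebra : IsClosed (S.algebra : Set (BoundedField (P × ℕ))) :=
  NonUnitalStarSubalgebra.isClosed_topologicalClosure _

theorem algebra_le {K : NonUnitalStarSubalgebra ℂ (BoundedField (P × ℕ))}
    (hK : IsClosed (K : Set (BoundedField (P × ℕ))))
    (hs : ∀ x m, BoundedField.single x m ∈ K) (hg : ∀ a, S.gen a ∈ K) : S.algebra ≤ K := by
  refine NonUnitalStarSubalgebra.topologicalClosure_minimal _
    (NonUnitalStarAlgebra.adjoin_le ?_) hK
  rintro _ (⟨y, rfl⟩ | ⟨a, rfl⟩)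
  exacts [hs _ _, hg a]

theorem generators_subset : S.generators ⊆ S.algebra :=
  (NonUnitalStarAlgebra.subset_adjoin ℂ _).trans
    (NonUnitalStarSubalgebra.le_topologicalClosure _)

theorem gen_mem (a : N) : S.gen a ∈ S.algebra := S.generators_subset (Or.inr ⟨a, rfl⟩)

theorem single_mem (x : P × ℕ) (m : PlaneOp) : BoundedField.single x m ∈ S.algebra := by
  have h : m = ∑ j, ∑ i, (inner ℂ (Plane.basis i) (m (Plane.basis j)) : ℂ) •
      (rankOne ℂ (Plane.basis i) (Plane.basis j) : PlaneOp) := by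
    conv_lhs => rw [planeOp_eq_sum m]
    refine Finset.sum_congr rfl fun j _ => ?_
    rw [ContinuousLinearMap.mul_def, comp_rankOne]
    conv_lhs => rw [← Plane.basis.sum_repr' (m (Plane.basis j))]
    rw [map_sum, sum_apply]
    refine Finset.sum_congr rfl fun i _ => ?_
    rw [map_smul]
    rfl
  rw [h, BoundedField.single_sum]
  refine sum_mem fun j _ => ?_
  rw [BoundedField.single_sum]
  refine sum_mem fun i _ => ?_
  rw [← BoundedField.single_smul]
  exact SMulMemClass.smul_mem _ (S.generators_subset (Or.inl ⟨(x, i, j), rfl⟩))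

end ProjectionSystem

namespace ProjectionSystem

/-! ### Scatteredness of the algebra of a system -/

section Scattered

variable {P N : Type*} (S : ProjectionSystem P N)

theorem map_mem_of_generators {B : Type*} [NonUnitalCStarAlgebra B] (f : S.algebra →⋆ₙₐ[ℂ] B)
    (C : NonUnitalStarSubalgebra ℂ B) (hC : IsClosed (C : Set B))
    (hs : ∀ x m, f ⟨_, S.single_mem x m⟩ ∈ C) (hg : ∀ a, f ⟨_, S.gen_mem a⟩ ∈ C)
    (g : S.algebra) : f g ∈ C := by
  have hK : IsClosed (((C.comap f).map (NonUnitalStarSubalgebraClass.subtype S.algebra) :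
      NonUnitalStarSubalgebra ℂ (BoundedField (P × ℕ))) : Set (BoundedField (P × ℕ))) := by
    rw [NonUnitalStarSubalgebra.coe_map, NonUnitalStarSubalgebra.coe_comap]
    exact S.isClosed_algebra.isClosedEmbedding_subtypeVal.isClosedMap _
      (hC.preimage f.continuous_of_cstar)
  have h := S.algebra_le hK (fun x m => ⟨_, hs x m, rfl⟩) (fun a => ⟨_, hg a, rfl⟩) g.2
  obtain ⟨g', hg', heq⟩ := h
  have : g' = g := Subtype.ext heq
  exact this ▸ hg'

/-- The elements of a C*-algebra which a given projection `p` multiplies into `ℂp`. -/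
def scalarAt {B : Type*} [NonUnitalCStarAlgebra B] (p : B) (hp : star p = p) :
    NonUnitalStarSubalgebra ℂ B where
  carrier := {b | p * b ∈ ℂ ∙ p ∧ b * p ∈ ℂ ∙ p}
  add_mem' := fun ha hb => ⟨by rw [mul_add]; exact add_mem ha.1 hb.1,
    by rw [add_mul]; exact add_mem ha.2 hb.2⟩
  zero_mem' := by simp
  mul_mem' := by
    rintro a b ⟨ha, ha'⟩ ⟨hb, hb'⟩
    obtain ⟨c, hc⟩ := Submodule.mem_span_singleton.1 ha
    obtain ⟨d, hd⟩ := Submodule.mem_span_singleton.1 hb'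
    refine ⟨?_, ?_⟩
    · rw [← mul_assoc, ← hc, smul_mul_assoc]
      exact Submodule.smul_mem _ _ hb
    · rw [mul_assoc, ← hd, mul_smul_comm]
      exact Submodule.smul_mem _ _ ha'
  smul_mem' := by
    rintro c a ⟨ha, ha'⟩
    refine ⟨?_, ?_⟩
    · rw [mul_smul_comm]; exact Submodule.smul_mem _ _ ha
    · rw [smul_mul_assoc]; exact Submodule.smul_mem _ _ ha'
  star_mem' := by
    rintro a ⟨ha, ha'⟩
    obtain ⟨c, hc⟩ := Submodule.mem_span_singleton.1 ha
    obtain ⟨d, hd⟩ := Submodule.mem_span_singleton.1 ha'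
    refine ⟨Submodule.mem_span_singleton.2 ⟨star d, ?_⟩,
      Submodule.mem_span_singleton.2 ⟨star c, ?_⟩⟩
    · have := congrArg star hd
      rwa [star_mul, star_smul, hp] at this
    · have := congrArg star hc
      rwa [star_mul, star_smul, hp] at this

theorem isClosed_scalarAt {B : Type*} [NonUnitalCStarAlgebra B] (p : B) (hp : star p = p) :
    IsClosed (scalarAt p hp : Set B) := by
  have h : IsClosed ((ℂ ∙ p : Submodule ℂ B) : Set B) := Submodule.closed_of_finiteDimensional _
  exact (h.preimage (continuous_const.mul continuous_id)).inter
    (h.preimage (continuous_id.mul continuous_const))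

/-- If the quotient kills the fields vanishing at infinity, the image of `p_a` for a minimal
surviving `a` absorbs every generator up to a scalar, since products with strictly smaller `c`
vanish. The elements it absorbs form a closed subalgebra, hence everything. -/
theorem isScattered {P N : Type u} (S : ProjectionSystem P N) : IsScatteredCStar S.algebra := by
  intro B _ f hf hB
  rcases exists_isMinimalProjection_or_eq_zero (NonUnitalStarSubalgebraClass.subtype S.algebra)
    Subtype.val_injective (fun x m => ⟨⟨_, S.single_mem x m⟩, rfl⟩) f hf with h | h0
  · exact h
  have hs : ∀ x m, f ⟨_, S.single_mem x m⟩ = 0 := by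
    intro x m
    refine h0 _ fun ε hε => (Set.finite_singleton x).subset fun y hy => ?_
    by_contra hne
    simp only [Set.mem_ofPred_eq] at hy
    have : (NonUnitalStarSubalgebraClass.subtype S.algebra ⟨_, S.single_mem x m⟩ :
      BoundedField (P × ℕ)) y = 0 := BoundedField.single_of_ne hne m
    rw [this, norm_zero] at hy
    linarith
  obtain ⟨a, ha, hmin⟩ : ∃ a, f ⟨_, S.gen_mem a⟩ ≠ 0 ∧
      ∀ c, S.rel c a → f ⟨_, S.gen_mem c⟩ = 0 := by
    have hne : {a | f ⟨_, S.gen_mem a⟩ ≠ 0}.Nonempty := by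
      by_contra hempty
      have hall : ∀ a, f ⟨_, S.gen_mem a⟩ = 0 := fun a => by
        by_contra h
        exact hempty ⟨a, h⟩
      have hzero : ∀ g, f g = 0 := fun g => by
        have := S.map_mem_of_generators f ⊥
          (by rw [NonUnitalStarAlgebra.coe_bot]; exact isClosed_singleton)
          (fun x m => by rw [hs]; exact zero_mem _) (fun a => by rw [hall]; exact zero_mem _) g
        exact NonUnitalStarAlgebra.mem_bot.1 this
      obtain ⟨b, hb⟩ := exists_ne (0 : B)
      obtain ⟨g, rfl⟩ := hf b
      exact hb (hzero g)
    obtain ⟨a, ha, hmin⟩ := S.wellFounded.has_min _ hne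
    refine ⟨a, ha, fun c hc => ?_⟩
    by_contra h
    exact hmin c h hc
  have hstar : ∀ b, star (f ⟨_, S.gen_mem b⟩) = f ⟨_, S.gen_mem b⟩ := fun b => by
    rw [← map_star]
    exact congrArg f (Subtype.ext (S.isStarProjection_gen b).isSelfAdjoint.star_eq)
  have hprod : ∀ b, f ⟨_, S.gen_mem a⟩ * f ⟨_, S.gen_mem b⟩ ∈ ℂ ∙ f ⟨_, S.gen_mem a⟩ := by
    intro b
    rcases S.meet a b with hdis | ⟨c, hc, hsupp, hfin⟩
    · have : (⟨_, S.gen_mem a⟩ * ⟨_, S.gen_mem b⟩ : S.algebra) = 0 :=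
        Subtype.ext (S.gen_mul_gen_of_disjoint hdis)
      rw [← map_mul, this, map_zero]
      exact zero_mem _
    · have : f (⟨_, S.gen_mem a⟩ * ⟨_, S.gen_mem b⟩ - ⟨_, S.gen_mem c⟩) = 0 :=
        h0 _ (S.vanishesAtInfinity_gen_mul_gen hsupp hfin)
      rw [map_sub, sub_eq_zero, map_mul] at this
      rw [this]
      rcases hc with rfl | hc
      · exact Submodule.mem_span_singleton_self _
      · rw [hmin c hc]
        exact zero_mem _
  have hidem : f ⟨_, S.gen_mem a⟩ * f ⟨_, S.gen_mem a⟩ = f ⟨_, S.gen_mem a⟩ := by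
    rw [← map_mul]
    exact congrArg f (Subtype.ext (S.isStarProjection_gen a).isIdempotentElem)
  refine ⟨f ⟨_, S.gen_mem a⟩, ⟨hidem, hstar a⟩, ha, fun b => ?_⟩
  obtain ⟨g, rfl⟩ := hf b
  have hmem := S.map_mem_of_generators f (scalarAt (f ⟨_, S.gen_mem a⟩) (hstar a))
    (isClosed_scalarAt _ _) (fun x m => by rw [hs]; exact zero_mem _)
    (fun b => ⟨hprod b, by
      obtain ⟨c, hc⟩ := Submodule.mem_span_singleton.1 (hprod b)
      refine Submodule.mem_span_singleton.2 ⟨star c, ?_⟩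
      have := congrArg star hc
      rwa [star_mul, star_smul, hstar, hstar] at this⟩) g
  obtain ⟨c, hc⟩ := Submodule.mem_span_singleton.1 hmem.1
  exact ⟨c, by rw [← hc, smul_mul_assoc, hidem]⟩

end Scattered

/-! ### Twisted systems and the failure of AF -/

section NotAF

variable {P N Λ : Type*} (S : ProjectionSystem P N)

/-- The fields which tend to `0` on the second basis vector along `{t} × ℕ`, as do their
adjoints. -/
def vanishingAt (t : P) : NonUnitalStarSubalgebra ℂ (BoundedField (P × ℕ)) where
  carrier := {f | Tendsto (fun n : ℕ => f (t, n) (Plane.basis 1)) atTop (𝓝 0) ∧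
    Tendsto (fun n : ℕ => star f (t, n) (Plane.basis 1)) atTop (𝓝 0)}
  add_mem' := by
    rintro f g ⟨hf, hf'⟩ ⟨hg, hg'⟩
    refine ⟨by simpa using hf.add hg, by simpa using hf'.add hg'⟩
  zero_mem' := by simp
  mul_mem' := by
    have key : ∀ f g : BoundedField (P × ℕ),
        Tendsto (fun n : ℕ => g (t, n) (Plane.basis 1)) atTop (𝓝 0) →
        Tendsto (fun n : ℕ => (f * g) (t, n) (Plane.basis 1)) atTop (𝓝 0) := by
      intro f g hg
      refine squeeze_zero_norm (a := fun n => ‖f‖ * ‖g (t, n) (Plane.basis 1)‖) (fun n => ?_) ?_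
      · exact (ContinuousLinearMap.le_opNorm (f (t, n)) (g (t, n) (Plane.basis 1))).trans
          (mul_le_mul_of_nonneg_right (f.norm_apply_le _) (norm_nonneg _))
      · simpa using hg.norm.const_mul ‖f‖
    rintro f g ⟨hf, hf'⟩ ⟨hg, hg'⟩
    exact ⟨key f g hg, by rw [star_mul]; exact key _ _ hf'⟩
  smul_mem' := by
    rintro c f ⟨hf, hf'⟩
    refine ⟨by simpa using hf.const_smul c, by
      rw [star_smul]; simpa using hf'.const_smul (star c)⟩
  star_mem' := by
    rintro f ⟨hf, hf'⟩
    exact ⟨hf', by rwa [star_star]⟩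

theorem isClosed_vanishingAt (t : P) :
    IsClosed (vanishingAt t : Set (BoundedField (P × ℕ))) := by
  have key : IsClosed {f : BoundedField (P × ℕ) |
      Tendsto (fun n : ℕ => f (t, n) (Plane.basis 1)) atTop (𝓝 0)} := by
    refine isClosed_of_closure_subset fun f hf => ?_
    refine Metric.tendsto_atTop.2 fun ε hε => ?_
    obtain ⟨g, hg, hfg⟩ := Metric.mem_closure_iff.1 hf (ε / 2) (half_pos hε)
    obtain ⟨n₀, hn₀⟩ := Metric.tendsto_atTop.1 hg (ε / 2) (half_pos hε)
    refine ⟨n₀, fun n hn => ?_⟩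
    have h1 := hn₀ n hn
    rw [dist_zero_right] at h1 ⊢
    have h2 : ‖(f - g) (t, n) (Plane.basis 1)‖ ≤ ‖f - g‖ := by
      refine (ContinuousLinearMap.le_opNorm _ _).trans ?_
      rw [Plane.basis.norm_eq_one, mul_one]
      exact BoundedField.norm_apply_le _ _
    rw [dist_eq_norm] at hfg
    have h3 : f (t, n) (Plane.basis 1) =
        (f - g) (t, n) (Plane.basis 1) + g (t, n) (Plane.basis 1) := by simp
    rw [h3]
    linarith [norm_add_le ((f - g) (t, n) (Plane.basis 1)) (g (t, n) (Plane.basis 1))]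
  exact key.inter (key.preimage continuous_star)

/-- Along a fibre the projection fields tend to `lineProj 0` or vanish, and `lineProj 0` kills the
second basis vector. No element can thus be the identity on a whole fibre. -/
theorem algebra_le_vanishingAt (t : P) : S.algebra ≤ vanishingAt t := by
  refine S.algebra_le (isClosed_vanishingAt t) (fun x m => ?_) fun a => ?_
  · have key : ∀ m : PlaneOp, Tendsto (fun n : ℕ =>
        (BoundedField.single x m : BoundedField (P × ℕ)) (t, n) (Plane.basis 1)) atTop (𝓝 0) := by
      intro m
      refine tendsto_const_nhds.congr' ?_
      filter_upwards [eventually_gt_atTop x.2] with n hn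
      rw [BoundedField.single_of_ne]
      · rfl
      · rintro rfl
        exact lt_irrefl _ hn
    exact ⟨key m, by rw [BoundedField.star_single]; exact key _⟩
  · have key : Tendsto (fun n : ℕ => S.gen a (t, n) (Plane.basis 1)) atTop (𝓝 0) := by
      by_cases ht : t ∈ S.supp a
      · have h := ((continuous_eval_const (Plane.basis 1)).tendsto _).comp
          (S.tendsto_gen a ht)
        rw [lineProj_basis_one, Real.sin_zero, Complex.ofReal_zero, zero_smul] at h
        exact h
      · refine tendsto_const_nhds.congr fun n => ?_
        rw [S.gen_of_notMem (x := (t, n)) ht]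
        rfl
    exact ⟨key, by rwa [(S.isStarProjection_gen a).isSelfAdjoint.star_eq]⟩

/-- The fields which are eventually a multiple of a given projection field along a filter. -/
def multipleAlong (a : N) (l : Filter P) : NonUnitalStarSubalgebra ℂ (BoundedField (P × ℕ)) where
  carrier := {f | ∃ c : ℂ, ∀ᶠ t in l, ∀ n : ℕ, f (t, n) = c • S.gen a (t, n)}
  add_mem' := by
    rintro f g ⟨c, hc⟩ ⟨d, hd⟩
    refine ⟨c + d, ?_⟩
    filter_upwards [hc, hd] with t h1 h2 n
    rw [BoundedField.add_apply, h1, h2, add_smul]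
  zero_mem' := ⟨0, by simp⟩
  mul_mem' := by
    rintro f g ⟨c, hc⟩ ⟨d, hd⟩
    refine ⟨c * d, ?_⟩
    filter_upwards [hc, hd] with t h1 h2 n
    rw [BoundedField.mul_apply, h1, h2, smul_mul_smul_comm, ← BoundedField.mul_apply,
      (S.isStarProjection_gen a).isIdempotentElem.eq]
  smul_mem' := by
    rintro c f ⟨d, hd⟩
    refine ⟨c * d, ?_⟩
    filter_upwards [hd] with t h n
    rw [BoundedField.smul_apply, h, smul_smul]
  star_mem' := by
    rintro f ⟨c, hc⟩
    refine ⟨star c, ?_⟩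
    filter_upwards [hc] with t h n
    rw [BoundedField.star_apply, h, star_smul, ← BoundedField.star_apply,
      (S.isStarProjection_gen a).isSelfAdjoint.star_eq]

/-- Countable completeness makes all terms of a convergent sequence multiples of `p_a` on one common
member of the filter. Evaluating at a single point of that member shows that the scalars converge.
-/
theorem isClosed_multipleAlong (a : N) (l : Filter P) [l.NeBot] [CountableInterFilter l]
    (ha : ∀ᶠ t in l, t ∈ S.supp a) :
    IsClosed (S.multipleAlong a l : Set (BoundedField (P × ℕ))) := by
  refine IsSeqClosed.isClosed fun F f hF hlim => ?_
  choose c hc using hF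
  have hev := (eventually_countable_forall.2 hc).and ha
  obtain ⟨t₀, h₀, ht₀⟩ := hev.exists
  have hpt : ∀ x, Tendsto (fun k => F k x) atTop (𝓝 (f x)) := fun x =>
    ((BoundedField.continuous_apply x).tendsto f).comp hlim
  have hclim : ∃ d, Tendsto c atTop (𝓝 d) := by
    refine ⟨inner ℂ (unitVec (S.angle a (t₀, 0))) (f (t₀, 0) (unitVec (S.angle a (t₀, 0)))), ?_⟩
    have h1 := ((continuous_eval_const (unitVec (S.angle a (t₀, 0)))).tendsto _).comp
      (hpt (t₀, 0))
    have h2 := (tendsto_const_nhds (x := unitVec (S.angle a (t₀, 0)))).inner (𝕜 := ℂ) h1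
    refine h2.congr fun k => ?_
    simp only [Function.comp_apply]
    rw [h₀, S.gen_of_mem (x := (t₀, 0)) ht₀, smul_apply, lineProj_unitVec,
      inner_smul_right, inner_unitVec_self, mul_one]
  obtain ⟨d, hd⟩ := hclim
  refine ⟨d, ?_⟩
  filter_upwards [hev] with t ht n
  refine tendsto_nhds_unique (hpt (t, n)) ?_
  simp only [ht.1]
  exact hd.smul_const _

/-- The generators beyond which the projection fields of a system cannot be organized into a
directed family: to each `ξ : Λ` belongs a projection field `p_ξ` and a filter along which all
elements of the algebra are eventually multiples of `p_ξ`, and for every choice of members of these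
filters, some two of these fields differ at a common point. -/
structure IsTwisted (top : Λ → N) (l : Λ → Filter P) : Prop where
  neBot : ∀ ξ, (l ξ).NeBot
  countableInter : ∀ ξ, CountableInterFilter (l ξ)
  compl_mem : ∀ ξ t, {t}ᶜ ∈ l ξ
  supp_mem : ∀ ξ, S.supp (top ξ) ∈ l ξ
  eventually_gen : ∀ ξ a, (∀ᶠ t in l ξ, t ∉ S.supp a) ∨
    (∀ᶠ t in l ξ, t ∈ S.supp a ∧ S.slope a t = S.slope (top ξ) t)
  exists_ne : ∀ U : Λ → Set P, (∀ ξ, U ξ ∈ l ξ) →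
    ∃ ξ η t, t ∈ U ξ ∧ t ∈ U η ∧ S.slope (top ξ) t ≠ S.slope (top η) t

theorem IsTwisted.algebra_le {S : ProjectionSystem P N} {top : Λ → N} {l : Λ → Filter P}
    (h : S.IsTwisted top l) (ξ : Λ) : S.algebra ≤ S.multipleAlong (top ξ) (l ξ) := by
  have := h.neBot ξ
  have := h.countableInter ξ
  refine S.algebra_le (S.isClosed_multipleAlong _ _ (h.supp_mem ξ)) (fun x m => ⟨0, ?_⟩) fun a => ?_
  · filter_upwards [h.compl_mem ξ x.1] with t ht n
    rw [zero_smul, BoundedField.single_of_ne]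
    rintro rfl
    exact ht rfl
  · rcases h.eventually_gen ξ a with ha | ha
    · refine ⟨0, ?_⟩
      filter_upwards [ha] with t ht n
      rw [S.gen_of_notMem (x := (t, n)) ht, zero_smul]
    · refine ⟨1, ?_⟩
      filter_upwards [ha, h.supp_mem ξ] with t ht ht' n
      rw [S.gen_of_mem (x := (t, n)) ht.1, S.gen_of_mem (x := (t, n)) ht', one_smul]
      simp only [angle, ht.2]

/-- The units of the finite-dimensional subalgebras approximating the `p_ξ` are eventually equal to
`p_ξ`. Twistedness yields two of them with different lines over a common fibre, and directedness an
element dominating both there. -/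
theorem IsTwisted.not_isAF {S : ProjectionSystem P N} {top : Λ → N} {l : Λ → Filter P}
    (h : S.IsTwisted top l) : ¬ IsAF S.algebra := by
  rintro ⟨D, -, hdir, hfin, hdense⟩
  have hunit : ∀ B ∈ D, ∃ u ∈ B, ∀ b ∈ B, u * b = b := fun B hB => by
    have := hfin B hB
    exact exists_left_unit_of_finiteDimensional B
  have hex : ∀ ξ, ∃ B ∈ D, ∃ u ∈ B,
      ∀ᶠ t in l ξ, ∀ n : ℕ, (u : BoundedField (P × ℕ)) (t, n) = S.gen (top ξ) (t, n) := by
    intro ξ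
    have := h.neBot ξ
    obtain ⟨b, hb, hdist⟩ := hdense.exists_dist_lt (⟨_, S.gen_mem (top ξ)⟩ : S.algebra)
      (one_half_pos (α := ℝ))
    simp only [Set.mem_iUnion, exists_prop, SetLike.mem_coe] at hb
    obtain ⟨B, hB, hbB⟩ := hb
    obtain ⟨u, huB, hu⟩ := hunit B hB
    refine ⟨B, hB, u, huB, ?_⟩
    obtain ⟨c, hc⟩ := h.algebra_le ξ b.2
    obtain ⟨d, hd⟩ := h.algebra_le ξ u.2
    have hub : (u : BoundedField (P × ℕ)) * b = b := congrArg Subtype.val (hu b hbB)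
    obtain ⟨t, ⟨htc, htd⟩, hts⟩ := ((hc.and hd).and (h.supp_mem ξ)).exists
    have hval : S.gen (top ξ) (t, 0) ≠ 0 := by
      rw [S.gen_of_mem (x := (t, 0)) hts, ← norm_ne_zero_iff, norm_lineProj]
      exact one_ne_zero
    -- Where `p_ξ` has norm `1`, an element within `1 / 2` of it cannot vanish.
    have hc0 : c ≠ 0 := by
      rintro rfl
      have h1 : ‖(S.gen (top ξ) - b : BoundedField (P × ℕ)) (t, 0)‖ < 1 / 2 := by
        refine (BoundedField.norm_apply_le _ _).trans_lt ?_
        rw [← dist_eq_norm]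
        exact hdist
      rw [BoundedField.sub_apply, htc, zero_smul, sub_zero, S.gen_of_mem (x := (t, 0)) hts,
        norm_lineProj] at h1
      norm_num at h1
    -- Eventually `b = c p_ξ` and `u = d p_ξ`, so `u b = b` reads `d c = c`, whence `d = 1`.
    have h2 := congrArg (fun f : BoundedField (P × ℕ) => f (t, 0)) hub
    simp only [BoundedField.mul_apply, htc, htd] at h2
    rw [smul_mul_smul_comm, ← BoundedField.mul_apply,
      (S.isStarProjection_gen _).isIdempotentElem.eq] at h2
    have h3 : d * c = c := smul_left_injective ℂ hval h2
    have h4 : d = 1 := mul_right_cancel₀ hc0 (by rw [h3, one_mul])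
    filter_upwards [hd] with t ht n
    rw [ht, h4, one_smul]
  choose B hB u huB hu using hex
  obtain ⟨ξ, η, t, htξ, htη, hne⟩ := h.exists_ne
    (fun ξ => {t | (∀ n : ℕ, (u ξ : BoundedField (P × ℕ)) (t, n) = S.gen (top ξ) (t, n)) ∧
      t ∈ S.supp (top ξ)}) fun ξ => (hu ξ).and (h.supp_mem ξ)
  obtain ⟨C, hC, hξC, hηC⟩ := hdir _ (hB ξ) _ (hB η)
  obtain ⟨q, -, hq⟩ := hunit C hC
  have hfix : ∀ ζ, u ζ ∈ C → t ∈ {t | (∀ n : ℕ, (u ζ : BoundedField (P × ℕ)) (t, n) =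
      S.gen (top ζ) (t, n)) ∧ t ∈ S.supp (top ζ)} → ∀ n : ℕ,
      (q : BoundedField (P × ℕ)) (t, n) (unitVec (S.angle (top ζ) (t, n))) =
        unitVec (S.angle (top ζ) (t, n)) := by
    intro ζ hζ ht n
    have h1 : (q : BoundedField (P × ℕ)) * u ζ = u ζ := congrArg Subtype.val (hq _ hζ)
    have h2 := congrArg (fun f : BoundedField (P × ℕ) => f (t, n)) h1
    simp only [BoundedField.mul_apply, ht.1, S.gen_of_mem (x := (t, n)) ht.2] at h2
    have h3 := congrArg (fun m : PlaneOp => m (unitVec (S.angle (top ζ) (t, n)))) h2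
    simpa [lineProj_unitVec] using h3
  -- Dividing by `n + 1` keeps the two angles distinct for every `n`, so `q` fixes two lines all
  -- along the fibre.
  have hone : ∀ n : ℕ, (q : BoundedField (P × ℕ)) (t, n) (Plane.basis 1) = Plane.basis 1 := by
    intro n
    refine apply_basis_one_of_fixed (hfix ξ (hξC (huB ξ)) htξ n) (hfix η (hηC (huB η)) htη n)
      (S.angle_mem _ _) (S.angle_mem _ _) fun heq => hne ?_
    have hn : ((n : ℝ) + 1) ≠ 0 := by positivity
    exact (div_left_inj' hn).1 heq
  have hlim := (S.algebra_le_vanishingAt t q.2).1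
  simp only [hone] at hlim
  have := tendsto_nhds_unique hlim tendsto_const_nhds
  exact Plane.basis.orthonormal.ne_zero 1 this.symm

end NotAF
end ProjectionSystem

/-! ### Density of C*-algebras -/

theorem mk_subsemigroup_closure_le {D : Type u} [Semigroup D] (s : Set D) :
    #(Subsemigroup.closure s) ≤ max #s ℵ₀ := by
  have h1 : Subsemigroup.closure s ≤
      MulHom.srange (FreeSemigroup.lift (fun x : s => (x : D))) := by
    rw [Subsemigroup.closure_le]
    exact fun x hx => ⟨FreeSemigroup.of ⟨x, hx⟩, by simp⟩
  have h2 : #(FreeSemigroup s) ≤ #(s × List s) :=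
    Cardinal.mk_le_of_injective (f := fun w => (w.head, w.tail)) fun a b h => by
      cases a; cases b; simpa using h
  calc #(Subsemigroup.closure s)
      ≤ #(MulHom.srange (FreeSemigroup.lift (fun x : s => (x : D)))) :=
        Cardinal.mk_le_mk_of_subset h1
    _ ≤ #(FreeSemigroup s) := Cardinal.mk_range_le
    _ ≤ #(s × List s) := h2
    _ = #s * #(List s) := by rw [Cardinal.mk_prod, Cardinal.lift_id, Cardinal.lift_id]
    _ ≤ max #s ℵ₀ := by
      have h3 : #(List s) ≤ max #s ℵ₀ := (Cardinal.mk_list_le_max s).trans (max_comm _ _).le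
      calc #s * #(List s) ≤ max #s ℵ₀ * max #s ℵ₀ := mul_le_mul' (le_max_left _ _) h3
        _ = max #s ℵ₀ := Cardinal.mul_eq_self (le_max_right _ _)

/-- The C*-algebra generated by a set `s` has density at most `max #s ℵ₀`. -/
theorem density_topologicalClosure_adjoin_le {D : Type u} [NonUnitalCStarAlgebra D] (s : Set D) :
    density (NonUnitalStarAlgebra.adjoin ℂ s).topologicalClosure ≤ max #s ℵ₀ := by
  set W := Subsemigroup.closure (s ∪ star s) with hW
  obtain ⟨Q, hQc, hQd⟩ := TopologicalSpace.exists_countable_dense ℂ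
  -- Combinations of words in the generators and their adjoints, with coefficients from a countable
  -- dense set, are the dense subset to be counted.
  let F : List (Q × W) → D := fun l => (l.map fun y => (y.1 : ℂ) • (y.2 : D)).sum
  have hspan : ∀ x, x ∈ NonUnitalStarAlgebra.adjoin ℂ s ↔ x ∈ Submodule.span ℂ (W : Set D) := by
    intro x
    rw [hW, ← NonUnitalStarAlgebra.adjoin_eq_span]
    rfl
  have hFmem : ∀ l, F l ∈ NonUnitalStarAlgebra.adjoin ℂ s := by
    intro l
    rw [hspan]
    refine list_sum_mem fun x hx => ?_
    obtain ⟨y, -, rfl⟩ := List.mem_map.1 hx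
    exact Submodule.smul_mem _ _ (Submodule.subset_span y.2.2)
  let M : AddSubmonoid D :=
    { carrier := Set.range F
      zero_mem' := ⟨[], rfl⟩
      add_mem' := by
        rintro _ _ ⟨l, rfl⟩ ⟨m, rfl⟩
        exact ⟨l ++ m, by simp [F]⟩ }
  have hcl : ∀ x ∈ NonUnitalStarAlgebra.adjoin ℂ s, x ∈ closure (Set.range F) := by
    intro x hx
    obtain ⟨n, c, g, rfl⟩ := Submodule.mem_span_set'.1 ((hspan x).1 hx)
    refine M.topologicalClosure.sum_mem fun i _ => ?_
    have : c i ∈ closure Q := hQd (c i)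
    refine map_mem_closure (f := fun z : ℂ => z • (g i : D)) (by fun_prop) this fun q hq => ?_
    exact ⟨[(⟨q, hq⟩, g i)], by simp [F]⟩
  let F' : List (Q × W) → (NonUnitalStarAlgebra.adjoin ℂ s).topologicalClosure := fun l =>
    ⟨F l, NonUnitalStarSubalgebra.le_topologicalClosure _ (hFmem l)⟩
  have hdense : Dense (Set.range F') := by
    rw [Topology.IsInducing.subtypeVal.dense_iff]
    intro x
    have h1 : Subtype.val '' Set.range F' = Set.range F := by
      rw [← Set.range_comp]; rfl
    refine (congrArg (fun t => (x : D) ∈ closure t) h1).mpr ?_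
    exact closure_minimal (fun y hy => hcl y hy) isClosed_closure x.2
  refine (density_le_of_dense hdense).trans (Cardinal.mk_range_le.trans ?_)
  refine (Cardinal.mk_list_le_max _).trans (max_le (le_max_right _ _) ?_)
  have hQ : Cardinal.lift.{u} #Q ≤ max #s ℵ₀ :=
    (Cardinal.lift_le_aleph0.2 (Cardinal.mk_le_aleph0_iff.2 hQc.to_subtype)).trans
      (le_max_right _ _)
  have hstar : #(star s : Set D) = #s := by
    rw [← Set.image_star]
    exact Cardinal.mk_image_eq star_injective
  have hWle : #W ≤ max #s ℵ₀ := by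
    refine (mk_subsemigroup_closure_le _).trans (max_le ?_ (le_max_right _ _))
    refine (Cardinal.mk_union_le _ _).trans ?_
    rw [hstar]
    exact (add_le_add (le_max_left _ _) (le_max_left _ _)).trans
      (Cardinal.add_eq_self (le_max_right #s ℵ₀)).le
  rw [Cardinal.mk_prod, Cardinal.lift_uzero]
  exact (mul_le_mul' hQ hWle).trans (Cardinal.mul_eq_self (le_max_right _ _)).le

namespace ProjectionSystem

variable {P N : Type u} (S : ProjectionSystem P N)

theorem density_algebra_le : density S.algebra ≤ max (max #P #N) ℵ₀ := by
  refine (density_topologicalClosure_adjoin_le S.generators).trans (max_le ?_ (le_max_right _ _))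
  refine (Cardinal.mk_union_le _ _).trans ?_
  have h0 : ℵ₀ ≤ max (max #P #N) ℵ₀ := le_max_right _ _
  have h1 : #((P × ℕ) × Fin 2 × Fin 2) ≤ max (max #P #N) ℵ₀ := by
    have key : ∀ (Y : Type u) (C : Type) [Countable C], #Y ≤ max (max #P #N) ℵ₀ →
        #(Y × C) ≤ max (max #P #N) ℵ₀ := fun Y C _ hY => by
      rw [Cardinal.mk_prod, Cardinal.lift_uzero]
      exact (mul_le_mul' hY ((Cardinal.lift_le_aleph0.2 Cardinal.mk_le_aleph0).trans h0)).trans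
        (Cardinal.mul_eq_self h0).le
    exact key _ _ (key _ _ ((le_max_left _ _).trans (le_max_left _ _)))
  refine (add_le_add (Cardinal.mk_range_le.trans h1) (Cardinal.mk_range_le.trans
    ((le_max_right _ _).trans (le_max_left _ _)))).trans (Cardinal.add_eq_self h0).le

theorem le_density_algebra {Λ : Type u} (top : Λ → N)
    (h : ∀ ξ η, ξ ≠ η → ∃ t ∈ S.supp (top ξ), t ∉ S.supp (top η)) : #Λ ≤ density S.algebra := by
  refine card_le_density (fun ξ => (⟨_, S.gen_mem (top ξ)⟩ : S.algebra)) fun ξ η hne => ?_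
  obtain ⟨t, ht, ht'⟩ := h ξ η hne
  have h1 : ‖(S.gen (top ξ) - S.gen (top η) : BoundedField (P × ℕ)) (t, 0)‖ = 1 := by
    rw [BoundedField.sub_apply, S.gen_of_mem (x := (t, 0)) ht,
      S.gen_of_notMem (x := (t, 0)) ht', sub_zero, norm_lineProj]
  rw [Subtype.dist_eq, dist_eq_norm, ← h1]
  exact BoundedField.norm_apply_le _ _

end ProjectionSystem

/-! ### Representation of bounded fields on a Hilbert space -/

/-- The Hilbert space of square summable functions with values in the plane. -/
abbrev PlaneSum (X : Type*) : Type _ := lp (fun _ : X => Plane) 2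

namespace BoundedField

variable {X : Type*}

theorem norm_apply_apply_le (f : BoundedField X) (v : PlaneSum X) (x : X) :
    ‖f x (v x)‖ ≤ ‖((‖f‖ : ℂ) • v : PlaneSum X) x‖ := by
  rw [lp.coeFn_smul, Pi.smul_apply, norm_smul, Complex.norm_real, norm_norm]
  exact (ContinuousLinearMap.le_opNorm _ _).trans
    (mul_le_mul_of_nonneg_right (f.norm_apply_le x) (norm_nonneg _))

/-- The pointwise action of a bounded field on a square summable function. -/
noncomputable def actOn (f : BoundedField X) (v : PlaneSum X) : PlaneSum X :=
  ⟨fun x => f x (v x), (lp.memℓp ((‖f‖ : ℂ) • v)).mono' fun x => f.norm_apply_apply_le v x⟩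

theorem norm_actOn_le (f : BoundedField X) (v : PlaneSum X) : ‖f.actOn v‖ ≤ ‖f‖ * ‖v‖ := by
  refine (lp.norm_mono two_ne_zero (x := f.actOn v) (y := (‖f‖ : ℂ) • v) fun x =>
    f.norm_apply_apply_le v x).trans ?_
  rw [norm_smul, Complex.norm_real, norm_norm]

/-- The block-diagonal operator given by a bounded field. -/
noncomputable def toOperator (f : BoundedField X) : PlaneSum X →L[ℂ] PlaneSum X :=
  LinearMap.mkContinuous
    { toFun := f.actOn
      map_add' := fun v w => lp.ext (funext fun x => map_add (f x) (v x) (w x))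
      map_smul' := fun c v => lp.ext (funext fun x => map_smul (f x) c (v x)) } ‖f‖
    f.norm_actOn_le

theorem toOperator_apply (f : BoundedField X) (v : PlaneSum X) (x : X) :
    f.toOperator v x = f x (v x) := rfl

/-- The representation of bounded fields by block-diagonal operators. -/
noncomputable def blockDiagonal : BoundedField X →⋆ₙₐ[ℂ] (PlaneSum X →L[ℂ] PlaneSum X) where
  toFun := toOperator
  map_smul' := fun c f => by ext1 v; exact lp.ext (funext fun x => rfl)
  map_zero' := by ext1 v; exact lp.ext (funext fun x => rfl)
  map_add' := fun f g => by ext1 v; exact lp.ext (funext fun x => rfl)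
  map_mul' := fun f g => by ext1 v; exact lp.ext (funext fun x => rfl)
  map_star' := fun f => by
    rw [ContinuousLinearMap.star_eq_adjoint, ContinuousLinearMap.eq_adjoint_iff]
    intro v w
    rw [lp.inner_eq_tsum, lp.inner_eq_tsum]
    refine tsum_congr fun x => ?_
    rw [toOperator_apply, toOperator_apply, star_apply, ContinuousLinearMap.star_eq_adjoint,
      ContinuousLinearMap.adjoint_inner_left]

theorem blockDiagonal_injective : Function.Injective (blockDiagonal (X := X)) := by
  classical
  intro f g h
  ext1 x
  ext1 v
  have h1 := congrArg (fun T : PlaneSum X →L[ℂ] PlaneSum X => T (lp.single 2 x v) x) h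
  change f x _ = g x _ at h1
  rwa [lp.single_apply_self] at h1

end BoundedField

open Classical in
theorem orthonormal_planeSum (X : Type*) : Orthonormal ℂ
    (fun y : X × Fin 2 => (lp.single 2 y.1 (Plane.basis y.2) : PlaneSum X)) := by
  rw [orthonormal_iff_ite]
  rintro ⟨x, i⟩ ⟨y, j⟩
  rw [lp.inner_single_left]
  by_cases h : x = y
  · subst h
    simp [Plane.inner_basis]
  · simp [h]

/-- The space of square summable plane-valued functions on `X` is isomorphic to `ℓ₂(ι)` whenever
`ι` is equipotent to `X × Fin 2`. -/
theorem exists_linearIsometryEquiv_planeSum {X ι : Type*} (e : X × Fin 2 ≃ ι) :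
    Nonempty (PlaneSum X ≃ₗᵢ[ℂ] lp (fun _ : ι => ℂ) 2) := by
  classical
  refine ⟨(HilbertBasis.mkOfOrthogonalEqBot
    ((orthonormal_planeSum X).comp e.symm e.symm.injective) ?_).repr⟩
  rw [Submodule.eq_bot_iff]
  intro v hv
  refine lp.ext (funext fun x => ?_)
  refine InnerProductSpace.ext_inner_left_basis Plane.basis.toBasis fun i => ?_
  have h := (Submodule.mem_orthogonal _ _).1 hv (lp.single 2 x (Plane.basis i))
    (Submodule.subset_span ⟨e (x, i), by simp⟩)
  rw [lp.inner_single_left] at h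
  simpa using h

theorem exists_injective_boundedOperators {X ι : Type*} (e : X × Fin 2 ≃ ι) :
    ∃ φ : BoundedField X →⋆ₙₐ[ℂ] BoundedOperatorsL2 ι, Function.Injective φ := by
  obtain ⟨U⟩ := exists_linearIsometryEquiv_planeSum e
  let Ψ : (PlaneSum X →L[ℂ] PlaneSum X) →⋆ₙₐ[ℂ] BoundedOperatorsL2 ι :=
    { U.conjStarAlgEquiv with
      map_smul' := fun c T => ContinuousLinearMap.ext fun v => U.map_smul c (T (U.symm v))
      map_zero' := ContinuousLinearMap.ext fun v => U.map_zero }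
  have hΨ : Function.Injective Ψ := U.conjStarAlgEquiv.injective
  exact ⟨Ψ.comp BoundedField.blockDiagonal, hΨ.comp BoundedField.blockDiagonal_injective⟩

theorem ProjectionSystem.IsTwisted.exists_subalgebra {P N Λ ι : Type u} {S : ProjectionSystem P N}
    {top : Λ → N} {l : Λ → Filter P} (h : S.IsTwisted top l) (e : (P × ℕ) × Fin 2 ≃ ι) :
    ∃ (A : NonUnitalStarSubalgebra ℂ (BoundedOperatorsL2 ι))
      (_ : IsClosed (A : Set (BoundedOperatorsL2 ι))),
      IsScatteredCStar A ∧ density A = density S.algebra ∧ ¬ IsAF A := by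
  obtain ⟨φ, hφ⟩ := exists_injective_boundedOperators e
  exact exists_closed_subalgebra_of_injective
    (φ.comp (NonUnitalStarSubalgebraClass.subtype S.algebra)) (hφ.comp Subtype.val_injective)
    S.isScattered h.not_isAF

/-! ### The system of pairs -/

section Pairs

variable {ι : Type*} [LinearOrder ι]

open Classical in
/-- The system of projections on unordered pairs: the field of `ξ` lives on the pairs containing
`ξ`, and its slope at a pair tells whether `ξ` is the larger element. -/
noncomputable def pairSystem (ι : Type*) [LinearOrder ι] :
    ProjectionSystem (Sym2 ι) (ι ⊕ Sym2 ι) where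
  supp := Sum.elim (fun ξ => {t | ξ ∈ t}) fun t => {t}
  slope := Sum.elim (fun ξ t => if ∃ η < ξ, t = s(η, ξ) then 1 else 0) fun _ _ => 0
  slope_mem := by
    rintro (ξ | t) t'
    · simp only [Sum.elim_inl]
      split_ifs <;> simp
    · simp
  -- Two ranks suffice: distinct elements share only one pair, so the product of their fields is, up
  -- to fields vanishing at infinity, that of a single pair, whose slope is irrelevant.
  rel := InvImage (· < ·) (Sum.elim (fun _ => 1) fun _ => 0 : ι ⊕ Sym2 ι → ℕ)
  wellFounded := InvImage.wf _ wellFounded_lt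
  meet := by
    rintro (ξ | t) (η | t')
    · right
      by_cases h : ξ = η
      · subst h
        exact ⟨Sum.inl ξ, Or.inl rfl, Set.inter_self _, by simp⟩
      · refine ⟨Sum.inr s(ξ, η), Or.inr (by simp [InvImage]), ?_,
          (Set.finite_singleton s(ξ, η)).subset fun t ht => ht.1⟩
        ext t
        exact Sym2.mem_and_mem_iff h
    · by_cases h : ξ ∈ t'
      · exact Or.inr ⟨Sum.inr t', Or.inr (by simp [InvImage]), by simpa using h,
          (Set.finite_singleton t').subset fun t ht => ht.1⟩
      · exact Or.inl (by simpa using h)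
    · by_cases h : η ∈ t
      · exact Or.inr ⟨Sum.inr t, Or.inl rfl, by simpa using h,
          (Set.finite_singleton t).subset fun t ht => ht.1⟩
      · exact Or.inl (by simpa using h)
    · by_cases h : t = t'
      · subst h
        exact Or.inr ⟨Sum.inr t, Or.inl rfl, Set.inter_self _, by simp⟩
      · exact Or.inl (by simpa using h)

/-- Take `A` of size `ℵ₁` and `η` outside `A` and all `C ξ` with `ξ ∈ A`. The countable set `C η`
cannot cover `A`, so some `ξ ∈ A` is left over. -/
theorem exists_pair_notMem {ι : Type u} (hι : ℵ₁ < #ι) (C : ι → Set ι)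
    (hC : ∀ ξ, (C ξ).Countable) : ∃ ξ η, ξ ≠ η ∧ η ∉ C ξ ∧ ξ ∉ C η := by
  obtain ⟨A, hA⟩ := Cardinal.le_mk_iff_exists_set.1 hι.le
  have hsmall : #(A ∪ ⋃ ξ ∈ A, C ξ : Set ι) ≤ ℵ₁ := by
    refine (Cardinal.mk_union_le _ _).trans ?_
    have h1 : #(⋃ ξ ∈ A, C ξ : Set ι) ≤ ℵ₁ := by
      refine (Cardinal.mk_biUnion_le _ _).trans ?_
      have h2 : ⨆ ξ : A, #(C ξ) ≤ ℵ₁ :=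
        ciSup_le' fun ξ => (Cardinal.mk_le_aleph0_iff.2 (hC ξ).to_subtype).trans
          (Cardinal.aleph0_le_aleph 1)
      exact (mul_le_mul' hA.le h2).trans (Cardinal.mul_eq_self (Cardinal.aleph0_le_aleph 1)).le
    exact (add_le_add hA.le h1).trans (Cardinal.add_eq_self (Cardinal.aleph0_le_aleph 1)).le
  obtain ⟨η, hη⟩ : ∃ η, η ∉ (A ∪ ⋃ ξ ∈ A, C ξ : Set ι) := by
    by_contra! hall
    rw [Set.eq_univ_of_forall hall, Cardinal.mk_univ] at hsmall
    exact hsmall.not_gt hι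
  obtain ⟨ξ, hξA, hξ⟩ : ∃ ξ ∈ A, ξ ∉ C η := by
    by_contra! hall
    have h1 : #A ≤ ℵ₀ := Cardinal.mk_le_aleph0_iff.2 ((hC η).mono hall).to_subtype
    rw [hA] at h1
    exact h1.not_gt Cardinal.aleph0_lt_aleph_one
  simp only [Set.mem_union, Set.mem_iUnion, not_or, not_exists] at hη
  exact ⟨ξ, η, fun h => hη.1 (h ▸ hξA), hη.2 ξ hξA, hξ⟩

theorem pairSystem_slope_eq_one {ξ η : ι} (h : ξ < η) :
    (pairSystem ι).slope (Sum.inl η) s(ξ, η) = 1 :=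
  if_pos ⟨ξ, h, rfl⟩

theorem pairSystem_slope_eq_zero {ξ η : ι} (h : ξ < η) :
    (pairSystem ι).slope (Sum.inl ξ) s(ξ, η) = 0 := by
  refine if_neg ?_
  rintro ⟨ζ, hζ, heq⟩
  rw [Sym2.eq_swap, Sym2.congr_left] at heq
  exact lt_asymm h (heq ▸ hζ)

/-- Members of the filters omit countably many partners of each `ξ`, so the free-pair lemma gives a
pair kept by both of its elements, where one has slope `1` and the other `0`. -/
theorem isTwisted_pairSystem {ι : Type u} [LinearOrder ι] (hι : ℵ₁ < #ι) :
    (pairSystem ι).IsTwisted Sum.inl fun ξ => (cocountable : Filter ι).map fun η => s(ξ, η) := by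
  have hunc : Uncountable ι := by
    rw [← Cardinal.aleph0_lt_mk_iff]
    exact Cardinal.aleph0_lt_aleph_one.trans hι
  have hev : ∀ (ξ : ι) (p : Sym2 ι → Prop), {η | ¬ p s(ξ, η)}.Countable →
      ∀ᶠ t in (cocountable : Filter ι).map (fun η => s(ξ, η)), p t := by
    intro ξ p h
    rw [eventually_map]
    exact mem_cocountable.2 h
  have hne : ∀ (ξ : ι) t, {η | ¬ s(ξ, η) ≠ t}.Countable := fun ξ t =>
    Set.Subsingleton.countable fun a ha b hb => by
      simp only [ne_eq, not_not, Set.mem_ofPred_eq] at ha hb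
      exact Sym2.congr_right.1 (ha.trans hb.symm)
  refine ⟨fun ξ => ?_, fun ξ => ?_, fun ξ t => hev ξ (· ≠ t) (hne ξ t), fun ξ => ?_,
    fun ξ a => ?_, fun U hU => ?_⟩
  · have : (cocountable : Filter ι).NeBot := by
      refine neBot_iff.2 fun h => ?_
      have : (∅ : Set ι) ∈ (cocountable : Filter ι) := h ▸ mem_bot
      rw [mem_cocountable, Set.compl_empty, Set.countable_univ_iff] at this
      exact not_countable this
    infer_instance
  · have : CountableInterFilter (cocountable : Filter ι) :=
      CardinalInterFilter.toCountableInterFilter _ Cardinal.aleph0_lt_aleph_one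
    infer_instance
  · exact hev ξ (ξ ∈ ·) (by simp)
  · rcases a with ζ | t
    · by_cases h : ζ = ξ
      · subst h
        exact Or.inr (hev ζ _ (by simp [pairSystem]))
      · refine Or.inl (hev ξ _ ((Set.countable_singleton ζ).mono fun η hη => ?_))
        simp only [pairSystem, Sum.elim_inl, Set.mem_ofPred_eq, not_not, Sym2.mem_iff] at hη
        exact (hη.resolve_left h).symm
    · exact Or.inl (hev ξ _ (hne ξ t))
  · obtain ⟨ξ, η, hξη, h1, h2⟩ := exists_pair_notMem hι (fun ξ => {η | s(ξ, η) ∈ U ξ}ᶜ)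
      fun ξ => mem_cocountable.1 (hU ξ)
    simp only [Set.mem_compl_iff, Set.mem_ofPred_eq, not_not] at h1 h2
    refine ⟨ξ, η, s(ξ, η), h1, by rwa [Sym2.eq_swap], ?_⟩
    rcases lt_or_gt_of_ne hξη with h | h
    · rw [pairSystem_slope_eq_one h, pairSystem_slope_eq_zero h]
      norm_num
    · rw [Sym2.eq_swap, pairSystem_slope_eq_one h, pairSystem_slope_eq_zero h]
      norm_num

end Pairs

theorem exists_subalgebra_density_aleph_two (ι : Type) (hι : #ι = ℵ_ 2) :
    ∃ (A : NonUnitalStarSubalgebra ℂ (BoundedOperatorsL2 ι))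
      (_ : IsClosed (A : Set (BoundedOperatorsL2 ι))),
      IsScatteredCStar A ∧ density A = ℵ_ 2 ∧ ¬ IsAF A := by
  classical
  let _ : LinearOrder ι := linearOrderOfSTO WellOrderingRel
  have hlt : ℵ₁ < #ι := by
    rw [hι]
    exact Cardinal.aleph_lt_aleph.2 (by norm_num)
  have hinf : ℵ₀ ≤ #ι := (Cardinal.aleph0_le_aleph 1).trans hlt.le
  have := Cardinal.infinite_iff.2 hinf
  have hP : #(Sym2 ι) = #ι := by
    refine le_antisymm ?_ ?_
    · refine (Cardinal.mk_le_of_surjective (f := fun p : ι × ι => s(p.1, p.2)) ?_).trans ?_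
      · exact Sym2.mk_surjective
      · rw [Cardinal.mk_prod, Cardinal.lift_id, Cardinal.mul_eq_self hinf]
    · exact Cardinal.mk_le_of_injective (f := fun ξ => s(ξ, ξ)) fun a b h => by simpa using h
  have he : #((Sym2 ι × ℕ) × Fin 2) = #ι := by
    simp only [Cardinal.mk_prod, hP, Cardinal.lift_uzero, Cardinal.mk_nat, Cardinal.mk_fin]
    rw [Cardinal.mul_eq_left hinf hinf Cardinal.aleph0_ne_zero,
      Cardinal.mul_eq_left hinf ((Cardinal.natCast_lt_aleph0 (n := 2)).le.trans hinf)
        (by norm_num)]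
  obtain ⟨e⟩ := Cardinal.eq.1 he
  obtain ⟨A, hA, h1, h2, h3⟩ := (isTwisted_pairSystem hlt).exists_subalgebra e
  refine ⟨A, hA, h1, ?_, h3⟩
  rw [h2, ← hι]
  -- The diagonal pair `s(ξ, ξ)` lies in the support of `ξ` alone, which separates the fields.
  refine le_antisymm ((pairSystem ι).density_algebra_le.trans ?_)
    ((pairSystem ι).le_density_algebra Sum.inl fun ξ η hne => ⟨s(ξ, ξ), ?_, ?_⟩)
  · rw [Cardinal.mk_sum, hP, Cardinal.lift_id, Cardinal.add_eq_self hinf]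
    simp [hinf]
  · simp [pairSystem]
  · simpa [pairSystem] using hne.symm

/-! ### Systems of branches -/

/-- A family of functions `branch ξ : I → [0, 1]` on a well-order, together with an indexing by `P`
of their restrictions to the proper initial segments of `I`. -/
structure BranchFamily (P I Λ : Type*) [LinearOrder I] [WellFoundedLT I] where
  /-- The functions of the family. -/
  branch : Λ → I → ℝ
  branch_mem : ∀ ξ α, branch ξ α ∈ Set.Icc (0 : ℝ) 1
  injective : Function.Injective branch
  /-- The index of the restriction of `branch ξ` to the elements below `α`. -/
  node : Λ → I → P
  node_eq_iff : ∀ ξ η α β,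
    node ξ α = node η β ↔ α = β ∧ ∀ γ < α, branch ξ γ = branch η γ

namespace BranchFamily

variable {P I Λ : Type*} [LinearOrder I] [WellFoundedLT I] (F : BranchFamily P I Λ)

theorem node_injective (ξ : Λ) : Function.Injective (F.node ξ) := fun _ _ h =>
  ((F.node_eq_iff _ _ _ _).1 h).1

/-- The place where two branches split. -/
theorem exists_split (ξ η : Λ) : ∃ δ : WithTop I,
    (∀ γ : I, γ < δ → F.branch ξ γ = F.branch η γ) ∧
      ∀ γ : I, (γ : WithTop I) = δ → F.branch ξ γ ≠ F.branch η γ := by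
  by_cases h : ∃ γ, F.branch ξ γ ≠ F.branch η γ
  · refine ⟨(wellFounded_lt.min {γ | F.branch ξ γ ≠ F.branch η γ} h : I), fun γ hγ => ?_,
      fun γ hγ => ?_⟩
    · by_contra hne
      exact wellFounded_lt.not_lt_min _ hne (WithTop.coe_lt_coe.1 hγ)
    · rw [WithTop.coe_inj.1 hγ]
      exact wellFounded_lt.min_mem _ h
  · push Not at h
    exact ⟨⊤, fun γ _ => h γ, fun γ hγ => absurd hγ (WithTop.coe_ne_top)⟩

theorem exists_split_of_ne {ξ η : Λ} (h : ξ ≠ η) : ∃ δ : I,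
    (∀ γ < δ, F.branch ξ γ = F.branch η γ) ∧ F.branch ξ δ ≠ F.branch η δ := by
  obtain ⟨δ, h1, h2⟩ := F.exists_split ξ η
  induction δ using WithTop.recTopCoe with
  | top => exact absurd (F.injective (funext fun γ => h1 γ (WithTop.coe_lt_top γ))) h
  | coe δ => exact ⟨δ, fun γ hγ => h1 γ (WithTop.coe_lt_coe.2 hγ), h2 δ rfl⟩

open Classical in
/-- The slope of a branch at a node. -/
noncomputable def slopeAt (ξ : Λ) (t : P) : ℝ :=
  if h : ∃ β, F.node ξ β = t then F.branch ξ h.choose else 0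

theorem slopeAt_node (ξ : Λ) (β : I) : F.slopeAt ξ (F.node ξ β) = F.branch ξ β := by
  have h : ∃ γ, F.node ξ γ = F.node ξ β := ⟨β, rfl⟩
  rw [slopeAt, dif_pos h, F.node_injective ξ h.choose_spec]

/-- The initial segment of a branch up to and including a given level. -/
def segment (ξ : Λ) (α : WithTop I) : Set P := {t | ∃ β : I, β ≤ α ∧ F.node ξ β = t}

theorem node_mem_segment {ξ η : Λ} {α : WithTop I} {β : I} :
    F.node ξ β ∈ F.segment η α ↔ β ≤ α ∧ ∀ γ < β, F.branch ξ γ = F.branch η γ := by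
  constructor
  · rintro ⟨γ, hγ, h⟩
    obtain ⟨rfl, h'⟩ := (F.node_eq_iff _ _ _ _).1 h
    exact ⟨hγ, fun δ hδ => (h' δ hδ).symm⟩
  · rintro ⟨h, h'⟩
    exact ⟨β, h, (F.node_eq_iff _ _ _ _).2 ⟨rfl, fun δ hδ => (h' δ hδ).symm⟩⟩

/-- The system of projections living on the initial segments of the branches. -/
noncomputable def system : ProjectionSystem P (Λ × WithTop I) where
  supp a := F.segment a.1 a.2
  slope a := F.slopeAt a.1
  slope_mem a t := by
    unfold slopeAt
    split_ifs
    · exact F.branch_mem _ _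
    · simp
  rel := InvImage (· < ·) Prod.snd
  wellFounded := InvImage.wf _ wellFounded_lt
  meet := by
    rintro ⟨ξ, α⟩ ⟨η, β⟩
    right
    obtain ⟨δ, hδ, hδ'⟩ := F.exists_split ξ η
    have hsplit : ∀ γ : I, (∀ ε < γ, F.branch ξ ε = F.branch η ε) ↔ γ ≤ δ := by
      intro γ
      refine ⟨fun h => ?_, fun h ε hε => hδ ε ((WithTop.coe_lt_coe.2 hε).trans_le h)⟩
      by_contra hlt
      rw [not_le] at hlt
      obtain ⟨d, rfl⟩ := WithTop.ne_top_iff_exists.1 (hlt.trans_le le_top).ne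
      exact hδ' d rfl (h d (WithTop.coe_lt_coe.1 hlt))
    -- The segments meet up to and including the node at the split `δ`. Only at that node can the
    -- slopes differ, because the node at `δ` records the values strictly below `δ`.
    refine ⟨(ξ, min α (min β δ)), ?_, ?_, ?_⟩
    · rcases (min_le_left α (min β δ)).eq_or_lt with h | h
      · exact Or.inl (by rw [h])
      · exact Or.inr h
    · ext t
      constructor
      · rintro ⟨⟨γ, hγ, rfl⟩, h⟩
        rw [F.node_mem_segment] at h
        exact ⟨γ, le_min hγ (le_min h.1 ((hsplit γ).1 h.2)), rfl⟩
      · rintro ⟨γ, hγ, rfl⟩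
        rw [le_min_iff, le_min_iff] at hγ
        exact ⟨⟨γ, hγ.1, rfl⟩, F.node_mem_segment.2 ⟨hγ.2.1, (hsplit γ).2 hγ.2.2⟩⟩
    · refine Set.Subsingleton.finite ?_
      have key : ∀ t ∈ {t ∈ F.segment ξ (min α (min β δ)) |
          ¬ (F.slopeAt ξ t = F.slopeAt ξ t ∧ F.slopeAt η t = F.slopeAt ξ t)},
          ∃ γ : I, γ = δ ∧ t = F.node ξ γ := by
        rintro _ ⟨⟨γ, hγ, rfl⟩, hne⟩
        rw [le_min_iff, le_min_iff] at hγ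
        refine ⟨γ, le_antisymm hγ.2.2 (not_lt.1 fun hlt => hne ⟨rfl, ?_⟩), rfl⟩
        rw [(F.node_eq_iff ξ η γ γ).2 ⟨rfl, (hsplit γ).2 hγ.2.2⟩, F.slopeAt_node,
          ← (F.node_eq_iff ξ η γ γ).2 ⟨rfl, (hsplit γ).2 hγ.2.2⟩, F.slopeAt_node, hδ γ hlt]
      intro t ht t' ht'
      obtain ⟨γ, hγ, rfl⟩ := key t ht
      obtain ⟨γ', hγ', rfl⟩ := key t' ht'
      rw [WithTop.coe_inj.1 (hγ.trans hγ'.symm)]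

theorem countableInterFilter_atTop {I : Type*} [LinearOrder I] [Nonempty I]
    (hI : ∀ C : Set I, C.Countable → ∃ b, ∀ c ∈ C, c < b) :
    CountableInterFilter (atTop : Filter I) := by
  refine ⟨fun S hS hmem => ?_⟩
  have h : ∀ s ∈ S, ∃ a : I, ∀ b ≥ a, b ∈ s := fun s hs => mem_atTop_sets.1 (hmem s hs)
  choose! a ha using h
  obtain ⟨b, hb⟩ := hI (a '' S) (hS.image a)
  refine mem_atTop_sets.2 ⟨b, fun c hc s hs => ha s hs c ?_⟩
  exact (hb _ ⟨s, hs, rfl⟩).le.trans hc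

/-- Distinct branches eventually leave each other, so along the tail of `ξ` only the full branch `ξ`
itself survives among the fields. The bounds on countable sets make the tail filter countably
complete. -/
theorem isTwisted {P I Λ : Type u} [LinearOrder I] [WellFoundedLT I]
    (F : BranchFamily P I Λ) [Nonempty I]
    (hI : ∀ C : Set I, C.Countable → ∃ b, ∀ c ∈ C, c < b) (hcard : #P < #Λ) :
    F.system.IsTwisted (fun ξ => (ξ, ⊤)) fun ξ => atTop.map (F.node ξ) := by
  have hgt : ∀ a : I, ∀ᶠ γ in atTop, a < γ := fun a => by
    obtain ⟨b, hb⟩ := hI {a} (Set.countable_singleton a)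
    filter_upwards [eventually_ge_atTop b] with γ hγ
    exact (hb a rfl).trans_le hγ
  have := countableInterFilter_atTop hI
  refine ⟨fun ξ => inferInstance, fun ξ => inferInstance, fun ξ t => ?_, fun ξ => ?_,
    fun ξ a => ?_, fun U hU => ?_⟩
  · rw [mem_map]
    by_cases h : ∃ β, F.node ξ β = t
    · obtain ⟨β, rfl⟩ := h
      filter_upwards [hgt β] with γ hγ heq
      exact hγ.ne' (F.node_injective ξ heq)
    · exact Eventually.of_forall fun γ hγ => h ⟨γ, hγ⟩
  · exact mem_map.2 (Eventually.of_forall fun γ => ⟨γ, le_top, rfl⟩)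
  · obtain ⟨η, α⟩ := a
    simp only [eventually_map]
    by_cases hηξ : η = ξ
    · subst hηξ
      induction α using WithTop.recTopCoe with
      | top => exact Or.inr (Eventually.of_forall fun γ => ⟨⟨γ, le_top, rfl⟩, rfl⟩)
      | coe α =>
        left
        filter_upwards [hgt α] with γ hγ hmem
        exact (WithTop.coe_le_coe.1 (F.node_mem_segment.1 hmem).1).not_gt hγ
    · left
      obtain ⟨δ, -, hδ⟩ := F.exists_split_of_ne hηξ
      filter_upwards [hgt δ] with γ hγ hmem
      exact hδ ((F.node_mem_segment.1 hmem).2 δ hγ).symm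
  · have h : ∀ ξ, ∃ a : I, ∀ b ≥ a, F.node ξ b ∈ U ξ := fun ξ => mem_atTop_sets.1 (hU ξ)
    choose a ha using h
    -- There are more branches than nodes, so two branches coincide up to a common threshold. They
    -- split at some later `δ`, where the node is still shared but the slopes, being the values at
    -- `δ`, differ.
    obtain ⟨ξ, η, heq, hne⟩ : ∃ ξ η, F.node ξ (a ξ) = F.node η (a η) ∧ ξ ≠ η := by
      by_contra! hinj
      exact (Cardinal.mk_le_of_injective (f := fun ξ => F.node ξ (a ξ))
        fun ξ η h => hinj ξ η h).not_gt hcard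
    obtain ⟨ha', hagree⟩ := (F.node_eq_iff _ _ _ _).1 heq
    obtain ⟨δ, hδ, hδ'⟩ := F.exists_split_of_ne hne
    have hle : a ξ ≤ δ := by
      by_contra hlt
      exact hδ' (hagree δ (not_le.1 hlt))
    have hnode : F.node ξ δ = F.node η δ := (F.node_eq_iff _ _ _ _).2 ⟨rfl, hδ⟩
    refine ⟨ξ, η, F.node ξ δ, ha ξ δ hle, ?_, ?_⟩
    · rw [hnode]
      exact ha η δ (ha' ▸ hle)
    · change F.slopeAt ξ (F.node ξ δ) ≠ F.slopeAt η (F.node ξ δ)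
      rwa [F.slopeAt_node, hnode, F.slopeAt_node]

theorem card_le_density {P I Λ : Type u} [LinearOrder I] [WellFoundedLT I]
    (F : BranchFamily P I Λ) (hI : ∀ a : I, ∃ b, a < b) : #Λ ≤ density F.system.algebra := by
  refine F.system.le_density_algebra (fun ξ => (ξ, ⊤)) fun ξ η hne => ?_
  obtain ⟨δ, -, hδ⟩ := F.exists_split_of_ne hne
  obtain ⟨γ, hγ⟩ := hI δ
  exact ⟨F.node ξ γ, ⟨γ, le_top, rfl⟩, fun h => hδ ((F.node_mem_segment.1 h).2 δ hγ)⟩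

open Classical in
/-- Index the restrictions of a family of functions by a sufficiently large type. -/
theorem exists_of_card_le {ι I Λ : Type} [LinearOrder I] [WellFoundedLT I] (G : Λ → I → ℝ)
    (hG : ∀ ξ α, G ξ α ∈ Set.Icc (0 : ℝ) 1) (hinj : Function.Injective G)
    (hcard : #(Set.range fun y : Λ × I => (y.2, fun β => if β < y.2 then G y.1 β else 0)) ≤ #ι) :
    Nonempty (BranchFamily ι I Λ) := by
  obtain ⟨j⟩ := hcard
  refine ⟨⟨G, hG, hinj, fun ξ α => j ⟨_, Set.mem_range_self (ξ, α)⟩, fun ξ η α β => ?_⟩⟩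
  rw [j.injective.eq_iff]
  refine Subtype.ext_iff.trans (Prod.ext_iff.trans ?_)
  constructor
  · rintro ⟨h1, h2⟩
    simp only at h1
    subst h1
    refine ⟨rfl, fun γ hγ => ?_⟩
    simpa [hγ] using congrFun h2 γ
  · rintro ⟨rfl, h⟩
    refine ⟨rfl, funext fun γ => ?_⟩
    by_cases hγ : γ < α
    · simp [hγ, h γ hγ]
    · simp [hγ]

end BranchFamily

/-- A twisted system of projections on `P` whose algebra has density bigger than the size of
`P`. -/
def HasLargeTwistedSystem (P : Type) : Prop :=
  ∃ (N Λ : Type) (S : ProjectionSystem P N) (top : Λ → N) (l : Λ → Filter P),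
    S.IsTwisted top l ∧ #P < density S.algebra

theorem HasLargeTwistedSystem.exists_subalgebra {ι : Type} [Infinite ι]
    (h : HasLargeTwistedSystem ι) :
    ∃ (A : NonUnitalStarSubalgebra ℂ (BoundedOperatorsL2 ι))
      (_ : IsClosed (A : Set (BoundedOperatorsL2 ι))),
      IsScatteredCStar A ∧ #ι < density A ∧ ¬ IsAF A := by
  obtain ⟨N, Λ, S, top, l, hS, hd⟩ := h
  have hinf : ℵ₀ ≤ #ι := Cardinal.aleph0_le_mk ι
  have he : #((ι × ℕ) × Fin 2) = #ι := by
    simp only [Cardinal.mk_prod, Cardinal.lift_uzero, Cardinal.mk_nat, Cardinal.mk_fin]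
    rw [Cardinal.mul_eq_left hinf hinf Cardinal.aleph0_ne_zero,
      Cardinal.mul_eq_left hinf ((Cardinal.natCast_lt_aleph0 (n := 2)).le.trans hinf)
        (by norm_num)]
  obtain ⟨e⟩ := Cardinal.eq.1 he
  obtain ⟨A, hA, h1, h2, h3⟩ := hS.exists_subalgebra e
  exact ⟨A, hA, h1, h2 ▸ hd, h3⟩

open Classical in
theorem hasLargeTwistedSystem_of_functions {ι I Λ : Type} [LinearOrder I] [WellFoundedLT I]
    [Nonempty I] (G : Λ → I → ℝ) (hG : ∀ ξ α, G ξ α ∈ Set.Icc (0 : ℝ) 1)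
    (hinj : Function.Injective G)
    (hcard : #(Set.range fun y : Λ × I => (y.2, fun β => if β < y.2 then G y.1 β else 0)) ≤ #ι)
    (hlt : #ι < #Λ) (hI : ∀ C : Set I, C.Countable → ∃ b, ∀ c ∈ C, c < b) :
    HasLargeTwistedSystem ι := by
  obtain ⟨F⟩ := BranchFamily.exists_of_card_le G hG hinj hcard
  exact ⟨_, _, F.system, _, _, F.isTwisted hI hlt, hlt.trans_le (F.card_le_density fun a => by
    obtain ⟨b, hb⟩ := hI {a} (Set.countable_singleton a)
    exact ⟨b, hb a rfl⟩)⟩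

theorem mk_Iio_toType_ord_lt {κ : Cardinal.{u}} (a : κ.ord.ToType) : #(Set.Iio a) < κ := by
  have h := Cardinal.mk_Iio_lt a (by rw [Cardinal.mk_ord_toType, Ordinal.type_toType])
  rwa [Cardinal.mk_ord_toType] at h

theorem mk_Iic_toType_ord_lt {κ : Cardinal.{u}} (hκ : ℵ₀ ≤ κ) (a : κ.ord.ToType) :
    #(Set.Iic a) < κ := by
  rw [← Set.Iio_insert]
  refine Cardinal.mk_insert_le.trans_lt ?_
  exact Cardinal.add_lt_of_lt hκ (mk_Iio_toType_ord_lt a)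
    (Cardinal.one_lt_aleph0.trans_le hκ)

/-! ### Binary sequences -/

theorem hasLargeTwistedSystem_continuum (ι : Type) (hι : #ι = 𝔠) : HasLargeTwistedSystem ι := by
  classical
  -- Minimality leaves at most `𝔠` sequences of each length below `κ`, hence at most `𝔠` nodes,
  -- while there are more than `𝔠` branches.
  set κ : Cardinal.{0} := sInf {κ | 𝔠 < 2 ^ κ} with hκ
  have hmem : 𝔠 < 2 ^ κ := csInf_mem (s := {κ | 𝔠 < 2 ^ κ}) ⟨𝔠, Cardinal.cantor 𝔠⟩
  have hle : κ ≤ 𝔠 := csInf_le' (Cardinal.cantor 𝔠)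
  have hsmall : ∀ μ < κ, 2 ^ μ ≤ 𝔠 := fun μ hμ => not_lt.1 fun h => hμ.not_ge (csInf_le' h)
  have hinf : ℵ₀ ≤ κ := by
    by_contra h
    rw [not_le] at h
    exact hmem.not_ge ((Cardinal.power_lt_aleph0 (Cardinal.natCast_lt_aleph0 (n := 2)) h).le.trans
      Cardinal.aleph0_le_continuum)
  have hmk : #κ.ord.ToType = κ := Cardinal.mk_ord_toType κ
  have : Nonempty κ.ord.ToType := by
    rw [← Cardinal.mk_ne_zero_iff, hmk]
    exact (Cardinal.aleph0_pos.trans_le hinf).ne'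
  refine hasLargeTwistedSystem_of_functions (I := κ.ord.ToType) (Λ := κ.ord.ToType → Bool)
    (fun ξ α => if ξ α then 1 else 0) (fun ξ α => by split_ifs <;> simp) ?_ ?_ ?_ ?_
  · intro ξ η h
    funext α
    have := congrFun h α
    by_cases h1 : ξ α <;> by_cases h2 : η α <;> simp_all
  · rw [hι]
    let f : (Σ α : κ.ord.ToType, (Set.Iio α → Bool)) → κ.ord.ToType × (κ.ord.ToType → ℝ) :=
      fun y => (y.1, fun β => if h : β < y.1 then (if y.2 ⟨β, h⟩ then 1 else 0) else 0)
    have hsub : (Set.range fun y : (κ.ord.ToType → Bool) × κ.ord.ToType =>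
        ((y.2, fun β => if β < y.2 then (if y.1 β then 1 else 0) else 0) :
          κ.ord.ToType × (κ.ord.ToType → ℝ))) ⊆ Set.range f := by
      rintro _ ⟨⟨ξ, α⟩, rfl⟩
      refine ⟨⟨α, fun β => ξ β⟩, Prod.ext rfl (funext fun β => ?_)⟩
      by_cases h : β < α <;> simp [f, h]
    refine (Cardinal.mk_le_mk_of_subset hsub).trans (Cardinal.mk_range_le.trans ?_)
    rw [Cardinal.mk_sigma]
    refine (Cardinal.sum_le_mk_mul_iSup _).trans ?_
    rw [hmk]
    have hsup : ⨆ α : κ.ord.ToType, #(Set.Iio α → Bool) ≤ 𝔠 := ciSup_le' fun α => by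
      rw [← Cardinal.power_def, Cardinal.mk_bool]
      exact hsmall _ (mk_Iio_toType_ord_lt α)
    exact (mul_le_mul' hle hsup).trans Cardinal.continuum_mul_self.le
  · rw [hι, ← Cardinal.power_def, Cardinal.mk_bool, hmk]
    exact hmem
  -- `κ` has uncountable cofinality: a sequence is determined by its restrictions along a cofinal
  -- `C`, so a countable `C` would give `2 ^ κ ≤ 𝔠 ^ ℵ₀ = 𝔠`.
  · intro C hC
    by_contra! hcon
    have hinj : Function.Injective (fun (s : κ.ord.ToType → Bool) (c : C) (β : Set.Iic c.1) =>
        s β) := by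
      intro s s' h
      funext β
      obtain ⟨c, hc, hβ⟩ := hcon β
      exact congrFun (congrFun h ⟨c, hc⟩) ⟨β, hβ⟩
    have h1 := Cardinal.mk_le_of_injective hinj
    rw [← Cardinal.power_def, Cardinal.mk_bool, hmk, Cardinal.mk_pi] at h1
    refine hmem.not_ge (h1.trans ?_)
    calc Cardinal.prod (fun c : C => #(Set.Iic c.1 → Bool))
        ≤ Cardinal.prod (fun _ : C => 𝔠) := Cardinal.prod_le_prod _ _ fun c => by
          rw [← Cardinal.power_def, Cardinal.mk_bool]
          exact hsmall _ (mk_Iic_toType_ord_lt hinf _)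
      _ = 𝔠 ^ #C := by rw [Cardinal.prod_const']
      _ ≤ 𝔠 ^ ℵ₀ := Cardinal.power_le_power_left Cardinal.continuum_ne_zero
          (Cardinal.mk_le_aleph0_iff.2 hC.to_subtype)
      _ = 𝔠 := Cardinal.continuum_power_aleph0

/-! ### Canadian trees -/

section Trees

variable {T : Type u} [PartialOrder T] [IsSetTree T]

/-- The predecessors of `s < t` form a proper initial segment of the predecessors of `t`. -/
def iioPrincipalSeg {s t : T} (h : s < t) :
    PrincipalSeg (fun x y : Set.Iio s => x < y) (fun x y : Set.Iio t => x < y) where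
  toFun x := ⟨x, x.2.trans h⟩
  inj' _ _ hxy := Subtype.ext (congrArg (fun z : Set.Iio t => (z : T)) hxy)
  map_rel_iff' := Iff.rfl
  top := ⟨s, h⟩
  mem_range_iff_rel' b := ⟨fun ⟨x, hx⟩ => hx ▸ x.2, fun hb => ⟨⟨b, hb⟩, rfl⟩⟩

instance (t : T) : IsWellOrder (Set.Iio t) (· < ·) := IsSetTree.wellOrder_Iio t

theorem nodeHeight_eq_typein {s t : T} (h : s < t) :
    nodeHeight s = Ordinal.typein (fun x y : Set.Iio t => x < y) ⟨s, h⟩ :=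
  (Ordinal.typein_top (iioPrincipalSeg h)).symm

theorem nodeHeight_lt {s t : T} (h : s < t) : nodeHeight s < nodeHeight t := by
  rw [nodeHeight_eq_typein h]
  exact Ordinal.typein_lt_type _ _

theorem exists_lt_nodeHeight_eq {t : T} {α : Ordinal.{u}} (h : α < nodeHeight t) :
    ∃ s < t, nodeHeight s = α := by
  obtain ⟨⟨s, hs⟩, rfl⟩ := Ordinal.typein_surj (fun x y : Set.Iio t => x < y) h
  exact ⟨s, hs, nodeHeight_eq_typein hs⟩

theorem IsMaxChain.mem_of_lt {b : Set T} (hb : IsMaxChain (· ≤ ·) b) {s t : T} (ht : t ∈ b)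
    (h : s < t) : s ∈ b := by
  have hchain : IsChain (· ≤ ·) (insert s b) := by
    refine hb.1.insert fun r hr hne => ?_
    rcases eq_or_ne r t with rfl | hrt
    · exact Or.inl h.le
    rcases hb.1 hr ht hrt with hle | hle
    · have hr' : r < t := lt_of_le_of_ne hle hrt
      rcases trichotomous_of (fun x y : Set.Iio t => x < y) ⟨s, h⟩ ⟨r, hr'⟩ with h1 | h1 | h1
      · exact Or.inl (le_of_lt h1)
      · exact absurd (congrArg Subtype.val h1) hne
      · exact Or.inr (le_of_lt h1)
    · exact Or.inl (h.le.trans hle)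
  rw [hb.2 hchain (Set.subset_insert s b)]
  exact Set.mem_insert s b

theorem IsChain.eq_of_nodeHeight_eq {b : Set T} (hb : IsChain (· ≤ ·) b) {s t : T} (hs : s ∈ b)
    (ht : t ∈ b) (h : nodeHeight s = nodeHeight t) : s = t := by
  by_contra hne
  rcases hb hs ht hne with h1 | h1
  · exact (nodeHeight_lt (lt_of_le_of_ne h1 hne)).ne h
  · exact (nodeHeight_lt (lt_of_le_of_ne h1 (Ne.symm hne))).ne h.symm

theorem exists_mem_nodeHeight_eq {b : Set T} (hb : IsMaxChain (· ≤ ·) b) {α : Ordinal.{u}}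
    (hα : α < subsetHeight b) : ∃ t ∈ b, nodeHeight t = α := by
  obtain ⟨⟨s, hs⟩, hlt⟩ : ∃ s : b, α < nodeHeight (s : T) + 1 := by
    by_contra! hcon
    exact hα.not_ge (Ordinal.iSup_le hcon)
  rcases (Order.lt_add_one_iff.1 hlt).eq_or_lt with h | h
  · exact ⟨s, hs, h.symm⟩
  · obtain ⟨r, hr, hrα⟩ := exists_lt_nodeHeight_eq h
    exact ⟨r, hb.mem_of_lt hs hr, hrα⟩

theorem nodeHeight_lt_subsetHeight {b : Set T} {t : T} (ht : t ∈ b) :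
    nodeHeight t < subsetHeight b :=
  (Order.lt_add_one_iff.2 le_rfl).trans_le
    (Ordinal.le_iSup (fun s : b => nodeHeight (s : T) + 1) ⟨t, ht⟩)

end Trees

theorem IsCanadianTree.mk_le {T : Type u} [PartialOrder T] (hT : IsCanadianTree T) : #T ≤ ℵ₁ := by
  have := hT.toIsSetTree
  have hcover : (Set.univ : Set T) ⊆ ⋃ α : (ℵ₁ : Cardinal.{u}).ord.ToType,
      treeLevel T (Ordinal.typein (α := (ℵ₁ : Cardinal.{u}).ord.ToType) (· < ·) α) := by
    intro t ht
    have h1 : nodeHeight t < Ordinal.type (α := (ℵ₁ : Cardinal.{u}).ord.ToType) (· < ·) := by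
      rw [Ordinal.type_toType, Cardinal.ord_aleph, ← hT.height_eq]
      exact nodeHeight_lt_subsetHeight ht
    obtain ⟨α, hα⟩ := Ordinal.typein_surj _ h1
    exact Set.mem_iUnion.2 ⟨α, hα.symm⟩
  rw [← Cardinal.mk_univ]
  refine (Cardinal.mk_le_mk_of_subset hcover).trans ((Cardinal.mk_iUnion_le _).trans ?_)
  rw [Cardinal.mk_ord_toType]
  exact (mul_le_mul' le_rfl (ciSup_le' fun α => hT.level_le _)).trans
    (Cardinal.mul_eq_self (Cardinal.aleph0_le_aleph 1)).le

theorem hasLargeTwistedSystem_of_isCanadianTree {T : Type} [PartialOrder T]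
    (hT : IsCanadianTree T) (ι : Type) (hι : #ι = ℵ₁) : HasLargeTwistedSystem ι := by
  classical
  have := hT.toIsSetTree
  have hinf : ℵ₀ ≤ ℵ₁ := Cardinal.aleph0_le_aleph 1
  have hmk : #(ℵ₁ : Cardinal.{0}).ord.ToType = ℵ₁ := Cardinal.mk_ord_toType _
  have : Nonempty (ℵ₁ : Cardinal.{0}).ord.ToType := by
    rw [← Cardinal.mk_ne_zero_iff, hmk]
    exact (Cardinal.aleph0_pos.trans_le hinf).ne'
  -- Since `#T ≤ ℵ₁ ≤ 𝔠`, tree elements can be coded by real numbers, and a branch becomes the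
  -- function listing the codes of its elements by level.
  obtain ⟨g⟩ : Nonempty (T ↪ Set.Icc (0 : ℝ) 1) := by
    have h : #T ≤ #(Set.Icc (0 : ℝ) 1) := by
      rw [Cardinal.mk_Icc_real one_pos]
      exact hT.mk_le.trans Cardinal.aleph_one_le_continuum
    exact h
  let ht : (ℵ₁ : Cardinal.{0}).ord.ToType → Ordinal.{0} := fun α =>
    Ordinal.typein (α := (ℵ₁ : Cardinal.{0}).ord.ToType) (· < ·) α
  have hht : ∀ α β, ht α < ht β ↔ α < β := fun α β =>
    Ordinal.typein_lt_typein (α := (ℵ₁ : Cardinal.{0}).ord.ToType) (· < ·)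
  have htype : Ordinal.type (α := (ℵ₁ : Cardinal.{0}).ord.ToType) (· < ·) = ω₁ := by
    rw [Ordinal.type_toType, Cardinal.ord_aleph]
  have hex : ∀ (b : treeBranches T ω₁) (α : (ℵ₁ : Cardinal.{0}).ord.ToType),
      ∃ t ∈ b.1, nodeHeight t = ht α := fun b α =>
    exists_mem_nodeHeight_eq b.2.1 (by
      rw [b.2.2, ← htype]
      exact Ordinal.typein_lt_type _ α)
  choose nd hnd hndht using hex
  have hcoh : ∀ b b' α α', nd b α = nd b' α' → α = α' ∧ ∀ β < α, nd b β = nd b' β := by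
    intro b b' α α' h
    have hα : α = α' := by
      have h1 : ht α = ht α' := by rw [← hndht b α, ← hndht b' α', h]
      exact Ordinal.typein_injective _ h1
    subst hα
    refine ⟨rfl, fun β hβ => ?_⟩
    obtain ⟨s, hs, hsβ⟩ := exists_lt_nodeHeight_eq (t := nd b α) (α := ht β)
      (by rw [hndht]; exact (hht _ _).2 hβ)
    have h1 : nd b β = s := b.2.1.1.eq_of_nodeHeight_eq (hnd b β) (b.2.1.mem_of_lt (hnd b α) hs)
      (by rw [hndht, hsβ])
    have h2 : nd b' β = s := b'.2.1.1.eq_of_nodeHeight_eq (hnd b' β)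
      (b'.2.1.mem_of_lt (hnd b' α) (h ▸ hs)) (by rw [hndht, hsβ])
    rw [h1, h2]
  refine hasLargeTwistedSystem_of_functions (I := (ℵ₁ : Cardinal.{0}).ord.ToType)
    (Λ := treeBranches T ω₁) (fun b α => g (nd b α)) (fun b α => (g _).2) ?_ ?_ ?_ ?_
  · intro b b' h
    have heq : ∀ α, nd b α = nd b' α := fun α => g.injective (Subtype.ext (congrFun h α))
    have hsub : ∀ c c' : treeBranches T ω₁, (∀ α, nd c α = nd c' α) → c.1 ⊆ c'.1 := by
      intro c c' hcc t htc
      have h1 : nodeHeight t < Ordinal.type (α := (ℵ₁ : Cardinal.{0}).ord.ToType) (· < ·) := by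
        rw [htype, ← c.2.2]
        exact nodeHeight_lt_subsetHeight htc
      obtain ⟨α, hα⟩ := Ordinal.typein_surj _ h1
      have h2 : t = nd c α := c.2.1.1.eq_of_nodeHeight_eq htc (hnd c α) (by rw [hndht]; exact hα.symm)
      rw [h2, hcc]
      exact hnd c' α
    exact Subtype.ext ((hsub b b' heq).antisymm (hsub b' b fun α => (heq α).symm))
  · rw [hι]
    refine le_trans ?_ hT.mk_le
    -- A tree element determines all its predecessors, so the restriction of a branch below `α`
    -- depends only on its element at level `α`. There are thus at most `#T` restrictions.
    have hfac : Function.FactorsThrough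
        (fun y : treeBranches T ω₁ × (ℵ₁ : Cardinal.{0}).ord.ToType =>
          ((y.2, fun β => if β < y.2 then (g (nd y.1 β) : ℝ) else 0) :
            (ℵ₁ : Cardinal.{0}).ord.ToType × ((ℵ₁ : Cardinal.{0}).ord.ToType → ℝ)))
        fun y => nd y.1 y.2 := by
      rintro ⟨b, α⟩ ⟨b', α'⟩ h
      obtain ⟨rfl, h'⟩ := hcoh b b' α α' h
      refine Prod.ext rfl (funext fun β => ?_)
      by_cases hβ : β < α
      · simp [hβ, h' β hβ]
      · simp [hβ]
    obtain ⟨e, he⟩ : ∃ e : T → (ℵ₁ : Cardinal.{0}).ord.ToType ×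
        ((ℵ₁ : Cardinal.{0}).ord.ToType → ℝ), _ = e ∘ _ :=
      (Function.factorsThrough_iff _).1 hfac
    rw [he]
    exact (Cardinal.mk_le_mk_of_subset (Set.range_comp_subset_range _ _)).trans Cardinal.mk_range_le
  · rw [hι]
    exact hT.lt_branches
  · intro C hC
    by_contra! hcon
    have hcover : (Set.univ : Set (ℵ₁ : Cardinal.{0}).ord.ToType) ⊆ ⋃ c ∈ C, Set.Iic c := by
      intro b _
      obtain ⟨c, hc, hbc⟩ := hcon b
      exact Set.mem_biUnion hc hbc
    have hcount : (Set.univ : Set (ℵ₁ : Cardinal.{0}).ord.ToType).Countable := by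
      refine (hC.biUnion fun c _ => ?_).mono hcover
      rw [← Set.countable_coe_iff, ← Cardinal.mk_le_aleph0_iff, ← Cardinal.lt_aleph_one_iff]
      exact mk_Iic_toType_ord_lt hinf c
    rw [← Set.countable_coe_iff, ← Cardinal.mk_le_aleph0_iff, Cardinal.mk_univ, hmk] at hcount
    exact hcount.not_gt Cardinal.aleph0_lt_aleph_one

/-! ### Extensions of scattered algebras -/

/-- A quotient that kills the kernel of `π` factors through `D`, where scatteredness applies. In the
application the kernel consists of fields vanishing at infinity. -/
theorem IsScatteredCStar.of_forall_or {G D : Type u} [NonUnitalCStarAlgebra G]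
    [NonUnitalCStarAlgebra D] (hD : IsScatteredCStar D) (π : G →⋆ₙₐ[ℂ] D)
    (hπ : Function.Surjective π)
    (h : ∀ (B : Type u) [NonUnitalCStarAlgebra B] (f : G →⋆ₙₐ[ℂ] B), Function.Surjective f →
      (∃ p : B, IsMinimalProjection p) ∨ ∀ g, π g = 0 → f g = 0) : IsScatteredCStar G := by
  intro B _ f hf hB
  refine (h B f hf).elim id fun hker => ?_
  obtain ⟨s, hs⟩ := hπ.hasRightInverse
  have key : ∀ g, f (s (π g)) = f g := fun g => by
    rw [← sub_eq_zero, ← map_sub]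
    exact hker _ (by rw [map_sub, hs, sub_self])
  have key' : ∀ g d, π g = d → f (s d) = f g := fun g d hgd => hgd ▸ key g
  let f' : D →⋆ₙₐ[ℂ] B :=
    { toFun := fun d => f (s d)
      map_smul' := fun c d => by
        rw [key' (c • s d) _ (by rw [map_smul, hs]), map_smul]; rfl
      map_zero' := by rw [key' 0 _ (map_zero π), map_zero]
      map_add' := fun d d' => by
        rw [key' (s d + s d') _ (by rw [map_add, hs, hs]), map_add]
      map_mul' := fun d d' => by
        rw [key' (s d * s d') _ (by rw [map_mul, hs, hs]), map_mul]
      map_star' := fun d => by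
        rw [key' (star (s d)) _ (by rw [map_star, hs]), map_star] }
  refine hD B f' (fun b => ?_) hB
  obtain ⟨g, rfl⟩ := hf b
  exact ⟨π g, key g⟩

/-! ### Ultrafilters along a Boolean embedding -/

theorem PowersetModFin.mk_surjective : Function.Surjective PowersetModFin.mk := fun g =>
  Filter.Germ.inductionOn g fun p => ⟨{n | p n}, rfl⟩

theorem PowersetModFin.mk_inter (A B : Set ℕ) :
    PowersetModFin.mk (A ∩ B) = PowersetModFin.mk A ⊓ PowersetModFin.mk B := rfl

theorem PowersetModFin.mk_union (A B : Set ℕ) :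
    PowersetModFin.mk (A ∪ B) = PowersetModFin.mk A ⊔ PowersetModFin.mk B := rfl

theorem PowersetModFin.mk_empty : PowersetModFin.mk ∅ = ⊥ := rfl

theorem PowersetModFin.mk_univ : PowersetModFin.mk Set.univ = ⊤ := rfl

section Pullback

variable {X : Type*} (E : BoundedLatticeHom (Set X) PowersetModFin)

/-- Nonprincipal ultrafilters on the natural numbers. -/
abbrev FreeUltrafilter : Type := {v : Ultrafilter ℕ // (v : Filter ℕ) ≤ cofinite}

theorem FreeUltrafilter.mem_of_diff_finite (v : FreeUltrafilter) {A B : Set ℕ} (hA : A ∈ v.1)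
    (h : (A \ B).Finite) : B ∈ v.1 := by
  have h1 : (A \ B)ᶜ ∈ (v.1 : Filter ℕ) := v.2 h.compl_mem_cofinite
  filter_upwards [hA, h1] with n h2 h3
  by_contra h4
  exact h3 ⟨h2, h4⟩

theorem FreeUltrafilter.exists_mem {A : Set ℕ} (hA : A.Infinite) : ∃ v : FreeUltrafilter,
    A ∈ v.1 := by
  have : NeBot (cofinite ⊓ 𝓟 A) := cofinite_inf_principal_neBot_iff.2 hA
  refine ⟨⟨Ultrafilter.of (cofinite ⊓ 𝓟 A), (Ultrafilter.of_le _).trans inf_le_left⟩, ?_⟩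
  exact (Ultrafilter.of_le (cofinite ⊓ 𝓟 A)) (mem_inf_of_right (mem_principal_self A))

/-- The ultrafilter of all sets whose image under `E` belongs to `v`. -/
def pullback (v : FreeUltrafilter) : Ultrafilter X :=
  Ultrafilter.ofComplNotMemIff
    { sets := {S | ∃ A ∈ v.1, PowersetModFin.mk A ≤ E S}
      univ_sets := ⟨Set.univ, univ_mem, by
        rw [PowersetModFin.mk_univ]; exact (TopHomClass.map_top E).ge⟩
      sets_of_superset := fun ⟨A, hA, h⟩ hST => ⟨A, hA, h.trans (OrderHomClass.mono E hST)⟩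
      inter_sets := fun ⟨A, hA, h⟩ ⟨B, hB, h'⟩ => ⟨A ∩ B, inter_mem hA hB, by
        rw [PowersetModFin.mk_inter]
        exact (inf_le_inf h h').trans (InfHomClass.map_inf E _ _).ge⟩ }
    fun S => by
      constructor
      · intro hS
        obtain ⟨A, hA⟩ := PowersetModFin.mk_surjective (E S)
        obtain ⟨B, hB⟩ := PowersetModFin.mk_surjective (E Sᶜ)
        refine ⟨A, ?_, hA.le⟩
        by_contra hAv
        refine hS ⟨B, v.mem_of_diff_finite (Ultrafilter.compl_mem_iff_notMem.2 hAv) ?_, hB.le⟩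
        have h1 : PowersetModFin.mk Set.univ ≤ PowersetModFin.mk (A ∪ B) := by
          rw [PowersetModFin.mk_univ, PowersetModFin.mk_union, hA, hB, ← SupHomClass.map_sup]
          exact (TopHomClass.map_top E).ge.trans_eq (congrArg E sup_compl_eq_top.symm)
        refine ((PowersetModFin.mk_le_mk_iff _ _).1 h1).subset fun n hn => ?_
        exact ⟨trivial, fun h => h.elim hn.1 hn.2⟩
      · rintro ⟨A, hA, h⟩ ⟨B, hB, h'⟩
        have h1 : PowersetModFin.mk (A ∩ B) ≤ PowersetModFin.mk ∅ := by
          rw [PowersetModFin.mk_inter, PowersetModFin.mk_empty]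
          refine (inf_le_inf h h').trans ?_
          rw [← InfHomClass.map_inf]
          exact (congrArg E (Set.inter_compl_self S)).trans_le (map_bot E).le
        exact v.1.empty_notMem
          (v.mem_of_diff_finite (inter_mem hA hB) ((PowersetModFin.mk_le_mk_iff _ _).1 h1))

theorem mem_pullback_iff {v : FreeUltrafilter} {S : Set X} {A : Set ℕ}
    (h : PowersetModFin.mk A = E S) : S ∈ pullback E v ↔ A ∈ v.1 := by
  constructor
  · rintro ⟨B, hB, hBS⟩
    exact v.mem_of_diff_finite hB ((PowersetModFin.mk_le_mk_iff _ _).1 (hBS.trans h.ge))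
  · exact fun hA => ⟨A, hA, h.le⟩

/-- The pairs consisting of a bounded field on the natural numbers and a bounded field on `X` with
the same limits along every nonprincipal ultrafilter and its pullback. -/
def matching : NonUnitalStarSubalgebra ℂ (BoundedField ℕ × BoundedField X) where
  carrier := {q | ∀ v : FreeUltrafilter, ∃ m : PlaneOp,
    Tendsto q.1 v.1 (𝓝 m) ∧ Tendsto q.2 (pullback E v) (𝓝 m)}
  add_mem' := fun hq hr v => by
    obtain ⟨m, h1, h2⟩ := hq v
    obtain ⟨m', h1', h2'⟩ := hr v
    exact ⟨m + m', h1.add h1', h2.add h2'⟩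
  zero_mem' := fun v => ⟨0, tendsto_const_nhds, tendsto_const_nhds⟩
  mul_mem' := fun hq hr v => by
    obtain ⟨m, h1, h2⟩ := hq v
    obtain ⟨m', h1', h2'⟩ := hr v
    exact ⟨m * m', h1.mul h1', h2.mul h2'⟩
  smul_mem' := fun c q hq v => by
    obtain ⟨m, h1, h2⟩ := hq v
    exact ⟨c • m, h1.const_smul c, h2.const_smul c⟩
  star_mem' := fun hq v => by
    obtain ⟨m, h1, h2⟩ := hq v
    exact ⟨star m, h1.star, h2.star⟩

theorem BoundedField.exists_tendsto {Y : Type*} (f : BoundedField Y) (v : Ultrafilter Y) :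
    ∃ m, Tendsto f v (𝓝 m) := by
  have : ProperSpace PlaneOp := FiniteDimensional.proper ℂ PlaneOp
  obtain ⟨m, -, hm⟩ := (isCompact_closedBall (0 : PlaneOp) ‖f‖).ultrafilter_le_nhds (v.map f)
    (le_principal_iff.2 (Filter.mem_map.2 (univ_mem' fun x => by
      simpa using f.norm_apply_le x)))
  exact ⟨m, hm⟩

/-- Limits along both ultrafilters always exist by compactness of balls of matrices, and they depend
continuously on the fields in norm. -/
theorem isClosed_matching :
    IsClosed (matching E : Set (BoundedField ℕ × BoundedField X)) := by
  refine isClosed_of_closure_subset fun q hq v => ?_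
  obtain ⟨m, hm⟩ := q.1.exists_tendsto v.1
  obtain ⟨m', hm'⟩ := q.2.exists_tendsto (pullback E v)
  refine ⟨m, hm, ?_⟩
  suffices h : m' = m by rwa [h] at hm'
  rw [← sub_eq_zero, ← norm_le_zero_iff]
  refine le_of_forall_pos_le_add fun ε hε => ?_
  obtain ⟨r, hr, hqr⟩ := Metric.mem_closure_iff.1 hq (ε / 2) (half_pos hε)
  obtain ⟨k, hk, hk'⟩ := hr v
  rw [dist_eq_norm, Prod.norm_def, max_lt_iff] at hqr
  have h1 : ‖m - k‖ ≤ ε / 2 := le_of_tendsto (hm.sub hk).norm (Eventually.of_forall fun n =>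
    (BoundedField.norm_apply_le (q.1 - r.1) n).trans hqr.1.le)
  have h2 : ‖m' - k‖ ≤ ε / 2 := le_of_tendsto (hm'.sub hk').norm (Eventually.of_forall fun n =>
    (BoundedField.norm_apply_le (q.2 - r.2) n).trans hqr.2.le)
  have h3 : m' - m = (m' - k) - (m - k) := by abel
  rw [h3]
  linarith [norm_sub_le (m' - k) (m - k)]

/-- If `h` were large on an infinite set, a free ultrafilter containing that set would give a
nonzero limit. -/
theorem vanishesAtInfinity_of_mem_matching {h : BoundedField ℕ}
    (hh : (h, (0 : BoundedField X)) ∈ matching E) : h.VanishesAtInfinity := by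
  intro ε hε
  by_contra hinf
  obtain ⟨v, hv⟩ := FreeUltrafilter.exists_mem hinf
  obtain ⟨m, h1, h2⟩ := hh v
  obtain rfl : m = 0 := tendsto_nhds_unique h2 (tendsto_const_nhds (x := (0 : PlaneOp)))
  exact absurd (ge_of_tendsto h1.norm hv) (by simpa using hε)

theorem single_mem_matching (n : ℕ) (m : PlaneOp) :
    (BoundedField.single n m, (0 : BoundedField X)) ∈ matching E := fun v =>
  ⟨0, tendsto_const_nhds.congr' (by
    have h : ({n} : Set ℕ)ᶜ ∈ (v.1 : Filter ℕ) := v.2 (Set.finite_singleton n).compl_mem_cofinite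
    filter_upwards [h] with k hk
    exact (BoundedField.single_of_ne hk m).symm), tendsto_const_nhds⟩

theorem eq_zero_of_mem_matching (hE : Function.Injective E) {f : BoundedField X}
    (hf : ((0 : BoundedField ℕ), f) ∈ matching E) : f = 0 := by
  ext1 x
  obtain ⟨A, hA⟩ := PowersetModFin.mk_surjective (E {x})
  -- As `E` is injective, `E {x} ≠ ⊥`. A free ultrafilter containing `A` then pulls back to the
  -- principal one at `x`, along which the limit of `f` is `f x`.
  have hinf : A.Infinite := fun hfin => by
    have h : E {x} = E ∅ := by
      rw [← hA]
      refine ((PowersetModFin.mk_eq_mk_iff A ∅).2 (by rwa [show symmDiff A ∅ = A from symmDiff_bot A])).trans ?_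
      exact (map_bot E).symm
    exact Set.singleton_ne_empty x (hE h)
  obtain ⟨v, hv⟩ := FreeUltrafilter.exists_mem hinf
  obtain ⟨m, h1, h2⟩ := hf v
  obtain rfl : m = 0 := tendsto_nhds_unique h1 (tendsto_const_nhds (x := (0 : PlaneOp)))
  refine tendsto_nhds_unique (tendsto_const_nhds.congr' ?_) h2
  have hx : {x} ∈ (pullback E v : Filter X) := (mem_pullback_iff E hA).2 hv
  filter_upwards [hx] with y hy
  rw [Set.mem_singleton_iff.1 hy]

-- The level sets of `f` are carried by `E` to sets of integers that partition `ℕ` modulo finite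
-- sets. Let `h` take on each of them the corresponding value of `f`; overlaps and gaps are finite
-- and invisible to free ultrafilters.
open Classical in
theorem exists_mem_matching_of_finite_range {f : BoundedField X} (hf : (Set.range f).Finite) :
    ∃ h : BoundedField ℕ, (h, f) ∈ matching E ∧ ‖h‖ ≤ ‖f‖ := by
  choose A hA using fun S => PowersetModFin.mk_surjective (E S)
  have hb : ∀ n, ‖(if h : ∃ x, n ∈ A (f ⁻¹' {f x}) then f h.choose else 0 : PlaneOp)‖ ≤ ‖f‖ :=
    fun n => by
      split_ifs
      · exact f.norm_apply_le _
      · simp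
  refine ⟨BoundedField.ofBound _ ‖f‖ hb, fun v => ?_, BoundedField.norm_le (norm_nonneg _) hb⟩
  have hmem : ∀ m, f ⁻¹' {m} ∈ pullback E v ↔ A (f ⁻¹' {m}) ∈ v.1 := fun m =>
    mem_pullback_iff E (hA _)
  obtain ⟨_, ⟨x, rfl⟩, hx⟩ : ∃ m ∈ Set.range f, f ⁻¹' {m} ∈ pullback E v := by
    rw [← Ultrafilter.finite_biUnion_mem_iff hf]
    exact Filter.mem_of_superset univ_mem fun x _ => Set.mem_biUnion ⟨x, rfl⟩ rfl
  have hother : ∀ᶠ n in (v.1 : Filter ℕ), ∀ m ∈ Set.range f, n ∈ A (f ⁻¹' {m}) → m = f x := by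
    refine (hf.eventually_all).2 fun m _ => ?_
    by_cases hm : m = f x
    · exact Eventually.of_forall fun _ _ => hm
    · have h1 : A (f ⁻¹' {m}) ∉ v.1 := fun h => by
        obtain ⟨y, hy, hy'⟩ := (pullback E v).nonempty_of_mem (inter_mem ((hmem m).2 h) hx)
        exact hm (hy.symm.trans hy')
      have h2 : (A (f ⁻¹' {m}))ᶜ ∈ (v.1 : Filter ℕ) := Ultrafilter.compl_mem_iff_notMem.2 h1
      filter_upwards [h2] with n hn hn'
      exact absurd hn' hn
  refine ⟨f x, tendsto_const_nhds.congr' ?_, tendsto_const_nhds.congr' ?_⟩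
  · have h1 : A (f ⁻¹' {f x}) ∈ (v.1 : Filter ℕ) := (hmem _).1 hx
    filter_upwards [hother, h1] with n hn hn'
    have hex : ∃ x, n ∈ A (f ⁻¹' {f x}) := ⟨x, hn'⟩
    simp only [BoundedField.ofBound_apply]
    rw [dif_pos hex]
    exact (hn _ ⟨_, rfl⟩ hex.choose_spec).symm
  · have h1 : f ⁻¹' {f x} ∈ (pullback E v : Filter X) := hx
    filter_upwards [h1] with y hy
    exact hy.symm

/-- The bounded fields with finitely many values. -/
def finiteRangeFields (X : Type*) : AddSubgroup (BoundedField X) where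
  carrier := {f | (Set.range f).Finite}
  add_mem' := fun {f g} hf hg => (hf.image2 (· + ·) hg).subset (by
    rintro _ ⟨x, rfl⟩
    exact ⟨f x, ⟨x, rfl⟩, g x, ⟨x, rfl⟩, rfl⟩)
  zero_mem' := (Set.finite_singleton (0 : PlaneOp)).subset (by
    rintro _ ⟨x, rfl⟩
    rfl)
  neg_mem' := fun {f} hf => (hf.image Neg.neg).subset (by
    rintro _ ⟨x, rfl⟩
    exact ⟨f x, ⟨x, rfl⟩, rfl⟩)

theorem mem_closure_finiteRangeFields (f : BoundedField X) :
    f ∈ (finiteRangeFields X).topologicalClosure := by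
  have : ProperSpace PlaneOp := FiniteDimensional.proper ℂ PlaneOp
  refine Metric.mem_closure_iff.2 fun ε hε => ?_
  obtain ⟨t, ht, hcov⟩ := Metric.totallyBounded_iff.1
    (isCompact_closedBall (0 : PlaneOp) ‖f‖).totallyBounded (ε / 2) (half_pos hε)
  have hex : ∀ x, ∃ m ∈ t, dist (f x) m < ε / 2 := fun x => by
    have h := hcov (by simpa using f.norm_apply_le x : f x ∈ Metric.closedBall (0 : PlaneOp) ‖f‖)
    simpa using h
  choose g hgt hg using hex
  have hb : ∀ x, ‖g x‖ ≤ ‖f‖ + ε / 2 := fun x => by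
    have h1 := norm_le_norm_add_norm_sub (f x) (g x)
    have h2 := hg x
    have h3 := f.norm_apply_le x
    rw [dist_eq_norm] at h2
    linarith
  refine ⟨BoundedField.ofBound g _ hb, ht.subset (by rintro _ ⟨x, rfl⟩; exact hgt x), ?_⟩
  rw [dist_eq_norm]
  refine (BoundedField.norm_le (half_pos hε).le fun x => ?_).trans_lt (half_lt_self hε)
  rw [BoundedField.sub_apply, BoundedField.ofBound_apply, ← dist_eq_norm]
  exact (hg x).le

/-- Fields with finitely many values are dense and lift without increase of norm. Completeness of
`matching E` extends norm-controlled lifting to their closure. -/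
theorem exists_mem_matching (f : BoundedField X) : ∃ h : BoundedField ℕ, (h, f) ∈ matching E := by
  have := isClosed_matching E
  let π : NormedAddGroupHom (matching E) (BoundedField X) :=
    AddMonoidHom.mkNormedAddGroupHom
      { toFun := fun q => q.1.2, map_zero' := rfl, map_add' := fun _ _ => rfl } 1
      fun q => by
        rw [one_mul]
        exact norm_snd_le q.1
  have hπ : π.SurjectiveOnWith (finiteRangeFields X) 1 := fun f hf => by
    obtain ⟨h, hh, hn⟩ := exists_mem_matching_of_finite_range E hf
    refine ⟨⟨_, hh⟩, rfl, ?_⟩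
    rw [one_mul]
    exact max_le hn le_rfl
  obtain ⟨⟨q, hq⟩, rfl, -⟩ :=
    controlled_closure_of_complete one_pos one_pos hπ f (mem_closure_finiteRangeFields f)
  exact ⟨q.1, hq⟩

end Pullback

/-! ### Transfer to separable Hilbert space, and the main theorem -/

/-- The matching pairs with second component in `D` map onto `D`, so they inherit its density as a
lower bound and the failure of AF. They embed in the fields on `ℕ` by the first component. The
kernel of the map to `D` vanishes at infinity on `ℕ`, which gives scatteredness. -/
theorem exists_subalgebra_of_hasBooleanEmbedding {X : Type} (hX : HasBooleanEmbedding X)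
    (D : NonUnitalStarSubalgebra ℂ (BoundedField X)) [hcl : IsClosed (D : Set (BoundedField X))]
    (hD : IsScatteredCStar D) (hAF : ¬ IsAF D) :
    ∃ (A : NonUnitalStarSubalgebra ℂ (BoundedOperatorsL2 ℕ))
      (_ : IsClosed (A : Set (BoundedOperatorsL2 ℕ))),
      IsScatteredCStar A ∧ density D ≤ density A ∧ ¬ IsAF A := by
  obtain ⟨E, hE⟩ := hX
  let G : NonUnitalStarSubalgebra ℂ (BoundedField ℕ × BoundedField X) :=
    matching E ⊓ D.comap (NonUnitalStarAlgHom.snd ℂ (BoundedField ℕ) (BoundedField X))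
  have hG : IsClosed (G : Set (BoundedField ℕ × BoundedField X)) :=
    (isClosed_matching E).inter (hcl.preimage continuous_snd)
  let φ : G →⋆ₙₐ[ℂ] BoundedField ℕ :=
    (NonUnitalStarAlgHom.fst ℂ (BoundedField ℕ) (BoundedField X)).comp
      (NonUnitalStarSubalgebraClass.subtype G)
  let π : G →⋆ₙₐ[ℂ] D := NonUnitalStarAlgHom.codRestrict
    ((NonUnitalStarAlgHom.snd ℂ (BoundedField ℕ) (BoundedField X)).comp
      (NonUnitalStarSubalgebraClass.subtype G)) D fun g => g.2.2
  have hφ : Function.Injective φ := by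
    refine (injective_iff_map_eq_zero φ).2 ?_
    rintro ⟨⟨h, f⟩, hm, hf⟩ (rfl : h = 0)
    obtain rfl := eq_zero_of_mem_matching E hE hm
    rfl
  have hπ : Function.Surjective π := by
    rintro ⟨f, hf⟩
    obtain ⟨h, hh⟩ := exists_mem_matching E f
    exact ⟨⟨(h, f), hh, hf⟩, rfl⟩
  have hsc : IsScatteredCStar G := hD.of_forall_or π hπ fun B _ f hf => by
    refine (exists_isMinimalProjection_or_eq_zero φ hφ (fun n m => ?_) f hf).imp id fun h g hg => ?_
    · exact ⟨⟨_, single_mem_matching E n m, D.zero_mem⟩, rfl⟩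
    · refine h g (vanishesAtInfinity_of_mem_matching E ?_)
      have h0 : g.1.2 = 0 := congrArg Subtype.val hg
      rw [← h0]
      exact g.2.1
  obtain ⟨e⟩ : Nonempty (ℕ × Fin 2 ≃ ℕ) := nonempty_equiv_of_countable
  obtain ⟨ψ, hψ⟩ := exists_injective_boundedOperators e
  obtain ⟨A, hA, h1, h2, h3⟩ := exists_closed_subalgebra_of_injective (ψ.comp φ) (hψ.comp hφ) hsc
    fun h => hAF (h.of_surjective π hπ)
  exact ⟨A, hA, h1, h2 ▸ density_le_of_surjective hπ π.continuous_of_cstar, h3⟩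

theorem HasBooleanEmbedding.congr {X Y : Type*} (e : X ≃ Y) (h : HasBooleanEmbedding X) :
    HasBooleanEmbedding Y := by
  obtain ⟨E, hE⟩ := h
  exact ⟨E.comp (CompleteLatticeHom.setPreimage e).toBoundedLatticeHom,
    hE.comp e.surjective.preimage_injective⟩

theorem infinite_of_mk_eq {ι : Type*} {κ : Cardinal} (hκ : ℵ₀ ≤ κ) (h : #ι = κ) : Infinite ι :=
  Cardinal.infinite_iff.2 (h ▸ hκ)

theorem exists_subalgebra_of_isCanadianTree {T : Type} [PartialOrder T] (hT : IsCanadianTree T)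
    {X : Type} (hX : #X = ℵ₁) (hE : HasBooleanEmbedding X) :
    ∃ (A : NonUnitalStarSubalgebra ℂ (BoundedOperatorsL2 ℕ))
      (_ : IsClosed (A : Set (BoundedOperatorsL2 ℕ))),
      IsScatteredCStar A ∧ ℵ₁ < density A ∧ ¬ IsAF A := by
  obtain ⟨N, Λ, S, top, l, hS, hd⟩ := hasLargeTwistedSystem_of_isCanadianTree hT X hX
  have hcard : #X = #(X × ℕ) := by
    have := infinite_of_mk_eq (Cardinal.aleph0_le_aleph 1) hX
    simp
  obtain ⟨e⟩ := Cardinal.eq.1 hcard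
  obtain ⟨A, hA, h1, h2, h3⟩ :=
    exists_subalgebra_of_hasBooleanEmbedding (hE.congr e) S.algebra S.isScattered hS.not_isAF
  exact ⟨A, hA, h1, hX ▸ hd.trans_le h2, h3⟩

theorem theorem1p10 :
    (∀ ι : Type, #ι = ℵ_ 2 →
      ∃ (A : NonUnitalStarSubalgebra ℂ (BoundedOperatorsL2 ι))
        (_ : IsClosed (A : Set (BoundedOperatorsL2 ι))),
        IsScatteredCStar A ∧ density A = ℵ_ 2 ∧ ¬ IsAF A) ∧
    (∀ ι : Type, #ι = 𝔠 →
      ∃ (A : NonUnitalStarSubalgebra ℂ (BoundedOperatorsL2 ι))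
        (_ : IsClosed (A : Set (BoundedOperatorsL2 ι))),
        IsScatteredCStar A ∧ 𝔠 < density A ∧ ¬ IsAF A) ∧
    ((∃ (T : Type) (_ : PartialOrder T), IsCanadianTree T) →
      ∀ ι : Type, #ι = ℵ₁ →
        ∃ (A : NonUnitalStarSubalgebra ℂ (BoundedOperatorsL2 ι))
          (_ : IsClosed (A : Set (BoundedOperatorsL2 ι))),
          IsScatteredCStar A ∧ ℵ₁ < density A ∧ ¬ IsAF A) ∧
    ((∃ (T : Type) (_ : PartialOrder T), IsCanadianTree T) →
      (∃ X : Type, #X = ℵ₁ ∧ HasBooleanEmbedding X) →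
        ∃ (A : NonUnitalStarSubalgebra ℂ (BoundedOperatorsL2 ℕ))
          (_ : IsClosed (A : Set (BoundedOperatorsL2 ℕ))),
          IsScatteredCStar A ∧ ℵ₁ < density A ∧ ¬ IsAF A) := by
  refine ⟨exists_subalgebra_density_aleph_two, fun ι hι => ?_, ?_, ?_⟩
  · have := infinite_of_mk_eq Cardinal.aleph0_le_continuum hι
    exact hι ▸ (hasLargeTwistedSystem_continuum ι hι).exists_subalgebra
  · rintro ⟨T, _, hT⟩ ι hι
    have := infinite_of_mk_eq (Cardinal.aleph0_le_aleph 1) hι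
    exact hι ▸ (hasLargeTwistedSystem_of_isCanadianTree hT ι hι).exists_subalgebra
  · rintro ⟨T, _, hT⟩ ⟨X, hX, hE⟩
    exact exists_subalgebra_of_isCanadianTree hT hX hE
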